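/- Let $n\ge 1$ and let $V=\mathbb C^{n+1}$ with basis $v_1,\dots,v_{n+1}$. For a tuple $f_*=(f_1,\dots,f_{n-1})$ of linear endomorphisms of $V$, let $$\mathrm{Fl}^{f_*}(V)=\Big\{(U_1,\dots,U_n)\in\prod_{j=1}^n\mathrm{Gr}_j(V)\ :\ f_j(U_j)\subset U_{j+1}\text{ for }1\le j\le n-1\Big\}$$ be the $f_*$-linear degenerate flag variety. Let $\mathrm{pr}_k:V\to V$ be the linear map with $v_k\mapsto 0$ and $v_l\mapsto v_l$ for $l\ne k$. The group $\mathrm{GL}(V)^n$ acts on the tuples $f_*$ by $(g\cdot f)_j=g_{j+1}f_jg_j^{-1}$. A regular broken rhyme scheme is a sequence $(b_1,\dots,b_{n-1})$ of non-negative integers with $b_1\le 1$, $b_{j+1}\le\max(b_1,\dots,b_j)+1$ for $1\le j\le n-2$, and with pairwise distinct nonzero entries. The PBW locus $U_{\rm PBW}$ is the union of the $\mathrm{GL}(V)^n$-orbits of the tuples $f_*$ with $f_j=\mathrm{id}$ if $b_j=0$ and $f_j=\mathrm{pr}_{b_j}$ if $b_j\neq0$, where $b$ runs over the regular broken rhyme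 schemes. Let $\mathcal D$ be the set of all sequences $\mathbf i=(i_1<\dots<i_k)$ of integers in $\{1,\dots,n-1\}$, including the empty one. For $\mathbf i\in\mathcal D$ put $d(\mathbf i)=k$. Let $\mathrm{pr}_{\mathbf i}=(f_1,\dots,f_{n-1})$ with $f_{i_t}=\mathrm{pr}_{i_t+1}$ for $1\le t\le k$ and all other $f_j=\mathrm{id}$, and let $\mathrm{Fl}^{\mathbf i}_{n+1}=\mathrm{Fl}^{\mathrm{pr}_{\mathbf i}}(V)$. For $1\le s\le n$ put $h_s=\#\{t: i_t<s\}$ and $\ell_s=h_s+s$. In the Weyl group $\mathfrak S_{n+1+d(\mathbf i)}$ of $\mathrm{SL}_{n+1+d(\mathbf i)}$, with simple reflections $s_a=(a\ a{+}1)$, let $$w_{\mathbf i}=w_nw_{n-1}\cdots w_1,\qquad w_s=s_{h_s+1}s_{h_s+2}\cdots s_{h_s+s}.$$ Let $X_{w_{\mathbf i}}$ be the Schubert variety of $w_{\mathbf i}$ in the variety of partial flags $W_1\subset\dots\subset W_n\subset\mathbb C^{n+1+d(\mathbf i)}$ with $\dim W_s=\ell_s$ (a partial flag variety of $\mathrm{SL}_{n+1+d(\mathbf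 i)}$), that is, the Zariski closure of the orbit, under the Borel subgroup of upper triangular matrices, of the flag whose $s$-th member is spanned by the standard basis vectors $e_{w_{\mathbf i}(1)},\dots,e_{w_{\mathbf i}(\ell_s)}$. Then: 1. For every $\mathbf i\in\mathcal D$ there is an isomorphism of projective varieties $\mathrm{Fl}^{\mathbf i}_{n+1}\cong X_{w_{\mathbf i}}$. 2. The map sending $\mathbf i$ to the orbit of $\mathrm{pr}_{\mathbf i}$ is a bijection from $\mathcal D$ onto the set of $\mathrm{GL}(V)^n$-orbits in $U_{\rm PBW}$: every $\mathrm{pr}_{\mathbf i}$ lies in $U_{\rm PBW}$, and every $f_*\in U_{\rm PBW}$ lies in the orbit of $\mathrm{pr}_{\mathbf i}$ for exactly one $\mathbf i\in\mathcal D$. For this $\mathbf i$, $\mathrm{Fl}^{f_*}(V)\cong X_{w_{\mathbf i}}$ as projective varieties. -/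

import Mathlib

open MvPolynomial

noncomputable section

namespace LinDegFlag

/-! ### Products of Grassmannians as projective varieties over `ℂ` -/

/-- A (closed) point of the product of Grassmannians `∏ j, Gr_{d j}(ℂ^N)`. -/
@[ext]
structure GrProd (N : ℕ) {ι : Type} (d : ι → ℕ) where
  space : ι → Submodule ℂ (Fin N → ℂ)
  finrank_space : ∀ j, Module.finrank ℂ (space j) = d j

variable {N : ℕ} {ι : Type} {d : ι → ℕ}

/-- Index type of the Plücker coordinates on `∏ j, Gr_{d j}(ℂ^N)`: for each factor `j`, the
`d j`-element subsets of `{0, …, N-1}`, written as increasing sequences. -/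
abbrev PluckerIndex (N : ℕ) {ι : Type} (d : ι → ℕ) : Type :=
  Σ j : ι, (Fin (d j) ↪o Fin N)

/-- `p` is a system of homogeneous Plücker coordinates of the tuple `x`: for each `j` there is a
basis of `x_j` such that the coordinates `p ⟨j, I⟩` are the maximal minors, with row set `I`, of
the matrix whose columns are the basis vectors. Such a system is unique up to rescaling each of
the factors `j` by a nonzero scalar. -/
def IsPlucker (x : GrProd N d) (p : PluckerIndex N d → ℂ) : Prop :=
  ∀ j, ∃ b : Module.Basis (Fin (d j)) ℂ (x.space j), ∀ I : Fin (d j) ↪o Fin N,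
    p ⟨j, I⟩ = Matrix.det (Matrix.of fun r c => (b c : Fin N → ℂ) (I r))

/-- Polynomials in the Plücker coordinates that are homogeneous of degree `e j` in the
coordinates of the `j`-th factor, for every `j`. -/
def IsMultiHomogeneous [DecidableEq ι] (F : MvPolynomial (PluckerIndex N d) ℂ) (e : ι → ℕ) :
    Prop :=
  IsWeightedHomogeneous (fun q : PluckerIndex N d => (Pi.single q.1 1 : ι → ℕ)) F e

/-- The Zariski topology on the product of Grassmannians: the nonvanishing loci of
multihomogeneous polynomials in the Plücker coordinates are a basis of open sets. -/
instance [DecidableEq ι] : TopologicalSpace (GrProd N d) :=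
  TopologicalSpace.generateFrom
    {D | ∃ (F : MvPolynomial (PluckerIndex N d) ℂ) (e : ι → ℕ), IsMultiHomogeneous F e ∧
      D = {x | ∀ p, IsPlucker x p → eval p F ≠ 0}}

/-- Let `X` be a subset of a product of Grassmannians, with the subspace topology, and `V` an open
subset of `X`. A function is regular on `V` if locally on `V` it is a quotient `F / G` of two
polynomials in the Plücker coordinates that are multihomogeneous of the same multidegree, where
`G` has no zero. (The values of `f` outside `V` are irrelevant.) -/
def RegularOn [DecidableEq ι] {X : Set (GrProd N d)} (V : Set X) (f : X → ℂ) : Prop :=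
  ∀ x ∈ V, ∃ W : Set X, IsOpen W ∧ x ∈ W ∧ W ⊆ V ∧
    ∃ (F G : MvPolynomial (PluckerIndex N d) ℂ) (e : ι → ℕ),
      IsMultiHomogeneous F e ∧ IsMultiHomogeneous G e ∧
      ∀ y ∈ W, ∀ p, IsPlucker (y : GrProd N d) p → eval p G ≠ 0 ∧ f y = eval p F / eval p G

/-- An isomorphism of varieties between two subvarieties of products of Grassmannians: a
homeomorphism for the Zariski topologies which identifies the regular functions on all open
subsets. -/
structure VarietyIso [DecidableEq ι] {N' : ℕ} {ι' : Type} [DecidableEq ι'] {d' : ι' → ℕ}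
    (X : Set (GrProd N d)) (Y : Set (GrProd N' d')) extends X ≃ₜ Y where
  regularOn_iff : ∀ V : Set Y, IsOpen V → ∀ f : Y → ℂ,
    RegularOn V f ↔ RegularOn (toHomeomorph ⁻¹' V) (f ∘ toHomeomorph)

/-! ### Linear degenerate flag varieties

The index `i : Fin (n - 1)` stands for the index `i + 1 ∈ {1, …, n - 1}` of a linear map, the index
`j : Fin n` for the index `j + 1 ∈ {1, …, n}` of a subspace. -/

/-- The space `V` of dimension `n + 1`. The basis vector `v_k` is `Pi.single (k - 1) 1`. -/
abbrev V (n : ℕ) : Type := Fin (n + 1) → ℂ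

/-- The parameter space `R = Hom(V, V)^{n-1}`. -/
abbrev R (n : ℕ) : Type := Fin (n - 1) → (V n →ₗ[ℂ] V n)

/-- The vertex `i` of the arrow `i → i + 1`. -/
def src {n : ℕ} (i : Fin (n - 1)) : Fin n := ⟨i, by omega⟩

/-- The vertex `i + 1` of the arrow `i → i + 1`. -/
def tgt {n : ℕ} (i : Fin (n - 1)) : Fin n := ⟨i + 1, by omega⟩

/-- The `f`-linear degenerate flag variety `Fl^f(V)` in `Gr_1(V) × ⋯ × Gr_n(V)`. -/
def linDegFlag {n : ℕ} (f : R n) : Set (GrProd (n + 1) fun j : Fin n => (j : ℕ) + 1) :=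
  {U | ∀ i, (U.space (src i)).map (f i) ≤ U.space (tgt i)}

/-- The orbit of `f` under the base change action of `GL(V)^n` on `R`. -/
def orbit {n : ℕ} (f : R n) : Set (R n) :=
  {f' | ∃ g : Fin n → (V n ≃ₗ[ℂ] V n),
    ∀ i, f' i = (g (tgt i)).toLinearMap ∘ₗ f i ∘ₗ (g (src i)).symm.toLinearMap}

/-- The projection `pr_k` along the `k`-th basis vector, `1 ≤ k ≤ n + 1`. -/
def pr (n k : ℕ) : V n →ₗ[ℂ] V n :=
  LinearMap.pi fun l => if (l : ℕ) + 1 = k then 0 else LinearMap.proj l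

/-- Broken rhyme schemes of length `m`: `b_1 ≤ 1` and `b_{i+1} ≤ max(b_1, …, b_i) + 1`
(the supremum over the empty set is `0`). -/
def IsBrokenRhymeScheme {m : ℕ} (b : Fin m → ℕ) : Prop :=
  ∀ i, b i ≤ (Finset.univ.filter fun j => j < i).sup b + 1

/-- Regular sequences: the nonzero entries are pairwise distinct. -/
def IsRegularScheme {m : ℕ} (b : Fin m → ℕ) : Prop :=
  ∀ i j, i ≠ j → b i ≠ 0 → b j ≠ 0 → b i ≠ b j

/-- The tuple of maps attached to a broken rhyme scheme. -/
def schemeMaps {n : ℕ} (b : Fin (n - 1) → ℕ) : R n :=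
  fun i => if b i = 0 then LinearMap.id else pr n (b i)

/-- The PBW locus: the union of the orbits of regular broken rhyme schemes of length `n - 1`. -/
def pbwLocus (n : ℕ) : Set (R n) :=
  {f | ∃ b : Fin (n - 1) → ℕ, IsBrokenRhymeScheme b ∧ IsRegularScheme b ∧
    f ∈ orbit (schemeMaps b)}

/-- The projection sequence `pr_𝐢`. A sequence `1 ≤ i_1 < ⋯ < i_k ≤ n - 1` is encoded by the finite
set `{i_1 - 1, …, i_k - 1}` in `Fin (n - 1)`. The map with (one-based) index `i_t` is `pr_{i_t + 1}`,
all others are the identity. -/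
def prSeq {n : ℕ} (I : Finset (Fin (n - 1))) : R n :=
  fun i => if i ∈ I then pr n ((i : ℕ) + 2) else LinearMap.id

/-! ### Schubert varieties -/

/-- The variety of partial flags in `ℂ^N` with dimensions `ℓ` (a monotone sequence); it is the
quotient of `SL_N` by the stabilizer of the standard flag `(ℂ^{ℓ_j})_j`. -/
def partialFlags (N : ℕ) {n : ℕ} (ℓ : Fin n → ℕ) : Set (GrProd N ℓ) :=
  {U | Monotone U.space}

/-- The flag of coordinate subspaces `w (ℂ^{ℓ_j})`, spanned by the basis vectors with index in
`w {1, …, ℓ_j}`. -/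
def coordSpace {N n : ℕ} (ℓ : Fin n → ℕ) (w : Equiv.Perm (Fin N)) (j : Fin n) :
    Submodule ℂ (Fin N → ℂ) :=
  Submodule.span ℂ ((fun a : Fin N => (Pi.single (w a) 1 : Fin N → ℂ)) '' {a | (a : ℕ) < ℓ j})

/-- The Schubert cell of `w`: the orbit of the coordinate flag of `w` under the Borel subgroup of
upper triangular matrices in `SL_N`. -/
def schubertCell {N n : ℕ} (ℓ : Fin n → ℕ) (w : Equiv.Perm (Fin N)) : Set (GrProd N ℓ) :=
  {U | ∃ b : Matrix.SpecialLinearGroup (Fin N) ℂ, (b : Matrix (Fin N) (Fin N) ℂ).BlockTriangular id ∧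
    ∀ j, U.space j = (coordSpace ℓ w j).map (b : Matrix (Fin N) (Fin N) ℂ).toLin'}

/-- The Schubert variety of `w`: the Zariski closure of its Schubert cell in the partial flag
variety. -/
def schubertVariety {N n : ℕ} (ℓ : Fin n → ℕ) (w : Equiv.Perm (Fin N)) : Set (GrProd N ℓ) :=
  closure (schubertCell ℓ w) ∩ partialFlags N ℓ

/-! ### The Schubert variety of a projection sequence -/

/-- The number `h_s`, `s = j + 1`, of the indices `t` with `i_t < s`. -/
def h {n : ℕ} (I : Finset (Fin (n - 1))) (j : Fin n) : ℕ :=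
  (I.filter fun i : Fin (n - 1) => (i : ℕ) < (j : ℕ)).card

theorem h_le {n : ℕ} (I : Finset (Fin (n - 1))) (j : Fin n) : h I j ≤ I.card :=
  Finset.card_filter_le _ _

/-- The dimension `ℓ_s = h_s + s`, `s = j + 1`. -/
def ell {n : ℕ} (I : Finset (Fin (n - 1))) (j : Fin n) : ℕ := h I j + ((j : ℕ) + 1)

/-- The simple reflection `s_{i+1}` in the symmetric group of `{1, …, m + 1}`, exchanging `i + 1` and
`i + 2` (which are `i` and `i + 1` when counted from zero). -/
def simpleReflection {m : ℕ} (i : Fin m) : Equiv.Perm (Fin (m + 1)) :=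
  Equiv.swap i.castSucc i.succ

/-- The element `w_s = s_{h_s + 1} s_{h_s + 2} ⋯ s_{h_s + s}`, `s = j + 1`, of the Weyl group of
`SL_{n + 1 + d}`, where `d` is the length of the projection sequence. -/
def wFactor {n : ℕ} (I : Finset (Fin (n - 1))) (j : Fin n) : Equiv.Perm (Fin (n + I.card + 1)) :=
  (List.ofFn fun t : Fin ((j : ℕ) + 1) =>
    simpleReflection (⟨h I j + t, by have := h_le I j; omega⟩ : Fin (n + I.card))).prod

/-- The Weyl group element `w_𝐢 = w_n w_{n-1} ⋯ w_1`. -/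
def wSeq {n : ℕ} (I : Finset (Fin (n - 1))) : Equiv.Perm (Fin (n + I.card + 1)) :=
  (List.ofFn fun j : Fin n => wFactor I j).reverse.prod

end LinDegFlag

end

noncomputable section

namespace LinDegFlag

section

/-! ### Minors as alternating maps -/

/-! Everything is reduced to flags squeezed between coordinate subspaces; indices are counted from
0, and `d` is the cardinality of `I`.

Orbits. One permutation of the basis, used at all vertices, carries a regular scheme to any other
regular scheme with the same zeros (`schemeMaps_mem_orbit`). Conversely, the set of arrows whose map
is not injective is an orbit invariant and recovers `I` from `prSeq I`.

Windows. The copy of `V` at vertex `j` is realised as the quotient `ℂ^{h_j+n+1} / ℂ^{h_j}` inside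
`ℂ^{n+1+d}`, basis vectors being labelled by their index modulo `n+1` after a renumbering. Crossing
an arrow of `I` shifts the window by one: the lowest vector dies, and a new top vector, not in the
image, inherits its label. This is exactly a coordinate projection. Taking preimages therefore turns
`f_j(U_j) ⊆ U_{j+1}` into `W_j ⊆ W_{j+1}`. The resulting bijection with `windowFlags I` is linear in
Plücker coordinates in both directions, hence an isomorphism (`windowIso`).

Schubert varieties. The permutation `wSeq I` sends the first `ℓ_j` indices to those below `h_j` and
the top `j+1` indices of the window. So its coordinate flag satisfies the window conditions, which
are closed and stable under the Borel subgroup; this bounds the Schubert variety from above.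
Conversely, as in a Bott–Samelson construction, every window flag is `g_{n-1} ⋯ g_0` applied to the
standard flag, with `g_s` invertible of Hessenberg type (`exists_prodDown_eq`). Moving each `g_s`
along a line towards the permutation matrix of `w_s` gives a curve of window flags. For all but
finitely many parameters the minors with rows `w(1), …, w(ℓ_j)` are nonzero, which forces the flag
into the cell (`mem_schubertCell`). Hence the original flag, at parameter 0, lies in the closure. -/

/-- The minor with row sequence `J` as an alternating function of the columns. -/
def minorMap {N k : ℕ} (J : Fin k → Fin N) : (Fin N → ℂ) [⋀^Fin k]→ₗ[ℂ] ℂ :=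
  Matrix.detRowAlternating.compLinearMap (LinearMap.funLeft ℂ ℂ J)

theorem minorMap_apply {N k : ℕ} (J : Fin k → Fin N) (b : Fin k → Fin N → ℂ) :
    minorMap J b = Matrix.det (Matrix.of fun r c => b c (J r)) := by
  rw [← Matrix.det_transpose]
  rfl

theorem isPlucker_iff {N : ℕ} {ι : Type} {d : ι → ℕ} (x : GrProd N d)
    (p : PluckerIndex N d → ℂ) :
    IsPlucker x p ↔ ∀ j, ∃ b : Module.Basis (Fin (d j)) ℂ (x.space j),
      ∀ I : Fin (d j) ↪o Fin N, p ⟨j, I⟩ = minorMap I (fun c => (b c : Fin N → ℂ)) := by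
  simp only [IsPlucker, minorMap_apply]

theorem minorMap_single {N k : ℕ} (J J' : Fin k ↪o Fin N) :
    minorMap J (fun c => (Pi.single (J' c) 1 : Fin N → ℂ)) = if J = J' then 1 else 0 := by
  rw [minorMap_apply]
  split_ifs with h
  · subst h
    rw [← Matrix.det_one (n := Fin k)]
    congr 1
    ext r c
    simp [Matrix.one_apply, Pi.single_apply]
  · obtain ⟨r, hr⟩ : ∃ r, J r ∉ Set.range J' := by
      by_contra! hc
      apply h
      have hsub : (Finset.univ.map J.toEmbedding) ⊆ Finset.univ.map J'.toEmbedding := by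
        intro y hy
        simp only [Finset.mem_map, Finset.mem_univ, true_and] at hy ⊢
        obtain ⟨a, rfl⟩ := hy
        exact hc a
      have heq := Finset.eq_of_subset_of_card_le hsub (by simp)
      have hrange : Set.range J = Set.range J' := by
        have := congrArg (fun s : Finset (Fin N) => (s : Set (Fin N))) heq
        simpa using this
      exact OrderEmbedding.range_inj.mp hrange
    refine Matrix.det_eq_zero_of_row_eq_zero r fun c => ?_
    simp only [Matrix.of_apply, Pi.single_apply, ite_eq_right_iff, one_ne_zero, imp_false]
    exact fun e => hr ⟨c, e.symm⟩

theorem sum_alternatingMap_apply {α M κ : Type*} [AddCommMonoid M] [Module ℂ M] (s : Finset α)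
    (ψ : α → M [⋀^κ]→ₗ[ℂ] ℂ) (v : κ → M) : (∑ a ∈ s, ψ a) v = ∑ a ∈ s, ψ a v := by
  classical
  induction s using Finset.induction_on with
  | empty => simp
  | insert a s ha ih => simp [Finset.sum_insert ha, ih]

/-- An alternating function of `k` vectors is a linear combination of minors. -/
theorem alternatingMap_eq_sum_minorMap {N k : ℕ} (φ : (Fin N → ℂ) [⋀^Fin k]→ₗ[ℂ] ℂ) :
    φ = ∑ J : Fin k ↪o Fin N, φ (fun c => Pi.single (J c) 1) • minorMap J := by
  refine Module.Basis.ext_alternating (Pi.basisFun ℂ (Fin N)) fun v hv => ?_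
  simp only [Pi.basisFun_apply]
  obtain ⟨J, σ, rfl⟩ : ∃ (J : Fin k ↪o Fin N) (σ : Equiv.Perm (Fin k)), v = J ∘ σ := by
    have hcard : (Finset.univ.image v).card = k := by
      rw [Finset.card_image_of_injective _ hv, Finset.card_fin]
    let J := (Finset.univ.image v).orderEmbOfFin hcard
    have hmem : ∀ a, ∃ c, J c = v a := fun a => by
      have : v a ∈ Set.range J := by
        rw [Finset.range_orderEmbOfFin]
        simp
      exact this
    choose s hs using hmem
    have hs_inj : Function.Injective s := fun a b e => hv (by rw [← hs, ← hs, e])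
    exact ⟨J, Equiv.ofBijective s (Finite.injective_iff_bijective.mp hs_inj),
      funext fun a => (hs a).symm⟩
  have hperm : ∀ ψ : (Fin N → ℂ) [⋀^Fin k]→ₗ[ℂ] ℂ,
      (ψ fun i => Pi.single ((J ∘ σ) i) 1) =
        Equiv.Perm.sign σ • ψ fun i => Pi.single (J i) 1 :=
    fun ψ => ψ.map_perm (fun i => (Pi.single (J i) 1 : Fin N → ℂ)) σ
  rw [hperm, hperm]
  congr 1
  rw [sum_alternatingMap_apply]
  simp [minorMap_single]

/-! ### Plücker coordinates -/

variable {N : ℕ} {ι : Type} {d : ι → ℕ}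

theorem exists_isPlucker (x : GrProd N d) : ∃ p, IsPlucker x p := by
  let b := fun j => Module.finBasisOfFinrankEq ℂ (x.space j) (x.finrank_space j)
  refine ⟨fun q => minorMap q.2 (fun c => (b q.1 c : Fin N → ℂ)), ?_⟩
  rw [isPlucker_iff]
  exact fun j => ⟨b j, fun I => rfl⟩

/-- An alternating form of top degree on `x_j` is a multiple of the determinant, so changing the
basis multiplies all minors by the same change-of-basis determinant. -/
theorem IsPlucker.exists_scale {x : GrProd N d} {p p' : PluckerIndex N d → ℂ}
    (hp : IsPlucker x p) (hp' : IsPlucker x p') :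
    ∃ c : ι → ℂ, (∀ j, c j ≠ 0) ∧ p' = fun q => c q.1 * p q := by
  rw [isPlucker_iff] at hp hp'
  choose b hb using hp
  choose b' hb' using hp'
  refine ⟨fun j => (b j).det (b' j), fun j => ((b j).isUnit_det (b' j)).ne_zero, ?_⟩
  funext ⟨j, I⟩
  have h := ((minorMap I).compLinearMap (x.space j).subtype).eq_smul_basis_det (b j)
  have h' := congrArg (fun f => f (b' j)) h
  rw [hb, hb', mul_comm]
  simpa using h'

/-- Scaling a single basis vector scales every maximal minor. Positivity of `d j` is essential: the
only minor of the zero space is 1. -/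
theorem IsPlucker.scale {x : GrProd N d} {p : PluckerIndex N d → ℂ} (hd : ∀ j, 0 < d j)
    (hp : IsPlucker x p) {c : ι → ℂ} (hc : ∀ j, c j ≠ 0) :
    IsPlucker x fun q => c q.1 * p q := by
  rw [isPlucker_iff] at hp ⊢
  intro j
  obtain ⟨b, hb⟩ := hp j
  let i₀ : Fin (d j) := ⟨0, hd j⟩
  let w : Fin (d j) → ℂˣ := fun a => if a = i₀ then Units.mk0 (c j) (hc j) else 1
  refine ⟨b.unitsSMul w, fun I => ?_⟩
  have : (fun a => ((b.unitsSMul w a : x.space j) : Fin N → ℂ)) =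
      Function.update (fun a => (b a : Fin N → ℂ)) i₀ (c j • (b i₀ : Fin N → ℂ)) := by
    funext a
    by_cases ha : a = i₀
    · subst ha
      simp [Module.Basis.unitsSMul_apply, w, Units.smul_def]
    · simp [Module.Basis.unitsSMul_apply, w, ha]
  rw [this, AlternatingMap.map_update_smul, Function.update_eq_self, hb, smul_eq_mul]

theorem eval_scale [Fintype ι] [DecidableEq ι] {F : MvPolynomial (PluckerIndex N d) ℂ} {e : ι → ℕ}
    (hF : IsMultiHomogeneous F e) (c : ι → ℂ) (p : PluckerIndex N d → ℂ) :
    eval (fun q => c q.1 * p q) F = (∏ j, c j ^ e j) * eval p F := by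
  rw [eval_eq, eval_eq, Finset.mul_sum]
  refine Finset.sum_congr rfl fun s hs => ?_
  have hw := hF (mem_support_iff.mp hs)
  simp only [mul_pow, Finset.prod_mul_distrib]
  have : ∏ q ∈ s.support, c q.1 ^ s q = ∏ j, c j ^ e j := by
    have he : ∀ j, e j = ∑ q ∈ s.support, if q.1 = j then s q else 0 := by
      intro j
      rw [← hw, Finsupp.weight_apply, Finsupp.sum, Finset.sum_apply]
      refine Finset.sum_congr rfl fun q _ => ?_
      simp [Pi.single_apply, eq_comm]
    simp only [he, ← Finset.prod_pow_eq_pow_sum]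
    rw [Finset.prod_comm]
    refine Finset.prod_congr rfl fun q _ => ?_
    simp [pow_ite]
  rw [this]
  ring

theorem IsMultiHomogeneous.eval_ne_zero_iff [Fintype ι] [DecidableEq ι]
    {F : MvPolynomial (PluckerIndex N d) ℂ} {e : ι → ℕ} (hF : IsMultiHomogeneous F e)
    {x : GrProd N d} {p p' : PluckerIndex N d → ℂ} (hp : IsPlucker x p) (hp' : IsPlucker x p') :
    eval p F ≠ 0 ↔ eval p' F ≠ 0 := by
  obtain ⟨c, hc, rfl⟩ := hp.exists_scale hp'
  rw [eval_scale hF]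
  have : ∏ j, c j ^ e j ≠ 0 := Finset.prod_ne_zero_iff.mpr fun j _ => pow_ne_zero _ (hc j)
  simp [this]

theorem IsMultiHomogeneous.forall_eval_ne_zero_iff [Fintype ι] [DecidableEq ι]
    {F : MvPolynomial (PluckerIndex N d) ℂ} {e : ι → ℕ} (hF : IsMultiHomogeneous F e)
    {x : GrProd N d} {p : PluckerIndex N d → ℂ} (hp : IsPlucker x p) :
    (∀ p', IsPlucker x p' → eval p' F ≠ 0) ↔ eval p F ≠ 0 :=
  ⟨fun h => h p hp, fun h _ hp' => (hF.eval_ne_zero_iff hp hp').mp h⟩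

/-! ### Isomorphisms given by linear substitutions of the Plücker coordinates -/

section Criterion

variable {N' : ℕ} {d' : ι → ℕ}

/-- A linear change of Plücker coordinates, separately in each factor. -/
def linearChange (c : ∀ j, (Fin (d' j) ↪o Fin N') → (Fin (d j) ↪o Fin N) → ℂ)
    (p : PluckerIndex N d → ℂ) : PluckerIndex N' d' → ℂ :=
  fun q => ∑ I, c q.1 q.2 I * p ⟨q.1, I⟩

/-- The substitution on polynomials dual to `linearChange`. -/
def pullback (c : ∀ j, (Fin (d' j) ↪o Fin N') → (Fin (d j) ↪o Fin N) → ℂ) :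
    MvPolynomial (PluckerIndex N' d') ℂ →ₐ[ℂ] MvPolynomial (PluckerIndex N d) ℂ :=
  aeval fun q => ∑ I, C (c q.1 q.2 I) * X ⟨q.1, I⟩

theorem eval_pullback (c : ∀ j, (Fin (d' j) ↪o Fin N') → (Fin (d j) ↪o Fin N) → ℂ)
    (p : PluckerIndex N d → ℂ) (F : MvPolynomial (PluckerIndex N' d') ℂ) :
    eval p (pullback c F) = eval (linearChange c p) F := by
  have : (eval p).comp (pullback c).toRingHom = eval (linearChange c p) := by
    apply MvPolynomial.ringHom_ext
    · intro r
      simp [pullback]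
    · intro q
      simp [pullback, linearChange]
  exact congrArg (fun f => f F) this

theorem IsMultiHomogeneous.pullback [DecidableEq ι] {F : MvPolynomial (PluckerIndex N' d') ℂ}
    {e : ι → ℕ} (hF : IsMultiHomogeneous F e)
    (c : ∀ j, (Fin (d' j) ↪o Fin N') → (Fin (d j) ↪o Fin N) → ℂ) :
    IsMultiHomogeneous (pullback c F) e := by
  rw [LinDegFlag.pullback, aeval_def, eval₂_eq]
  refine IsWeightedHomogeneous.sum _ _ _ fun s hs => ?_
  rw [algebraMap_eq]
  refine IsWeightedHomogeneous.C_mul ?_ _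
  have hw := hF (mem_support_iff.mp hs)
  rw [← hw, Finsupp.weight_apply, Finsupp.sum]
  refine IsWeightedHomogeneous.prod _ _ _ fun q _ => ?_
  refine IsWeightedHomogeneous.pow ?_ _
  refine IsWeightedHomogeneous.sum _ _ _ fun I _ => ?_
  refine IsWeightedHomogeneous.C_mul ?_ _
  exact isWeightedHomogeneous_X _ _ (⟨q.1, I⟩ : PluckerIndex N d)

variable [DecidableEq ι] {X : Set (GrProd N d)} {Y : Set (GrProd N' d')}

/-- A linear substitution preserves multidegrees, so preimages of basic open sets are basic open
sets. -/
theorem continuous_of_linearChange [Fintype ι] (e : X ≃ Y)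
    (c : ∀ j, (Fin (d' j) ↪o Fin N') → (Fin (d j) ↪o Fin N) → ℂ)
    (hc : ∀ (x : X) p, IsPlucker (x : GrProd N d) p →
      IsPlucker (e x : GrProd N' d') (linearChange c p)) :
    Continuous e := by
  rw [continuous_induced_rng]
  refine continuous_generateFrom_iff.mpr ?_
  rintro _ ⟨F, m, hF, rfl⟩
  refine isOpen_induced_iff.mpr
    ⟨_, TopologicalSpace.isOpen_generateFrom_of_mem ⟨_, m, hF.pullback c, rfl⟩, ?_⟩
  ext x
  obtain ⟨p, hp⟩ := exists_isPlucker (x : GrProd N d)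
  simp only [Set.mem_preimage, Set.mem_ofPred_eq, Function.comp_apply]
  rw [(hF.pullback c).forall_eval_ne_zero_iff hp, hF.forall_eval_ne_zero_iff (hc x p hp),
    eval_pullback]

theorem RegularOn.comp_linearChange (e : X ≃ₜ Y)
    (c : ∀ j, (Fin (d' j) ↪o Fin N') → (Fin (d j) ↪o Fin N) → ℂ)
    (hc : ∀ (x : X) p, IsPlucker (x : GrProd N d) p →
      IsPlucker (e x : GrProd N' d') (linearChange c p))
    {W : Set Y} {f : Y → ℂ} (hf : RegularOn W f) : RegularOn (e ⁻¹' W) (f ∘ e) := by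
  intro x hx
  obtain ⟨W', hW', hxW', hsub, F, G, m, hF, hG, hval⟩ := hf (e x) hx
  refine ⟨e ⁻¹' W', hW'.preimage e.continuous, hxW', Set.preimage_mono hsub, pullback c F,
    pullback c G, m, hF.pullback c, hG.pullback c, fun y hy p hp => ?_⟩
  rw [eval_pullback, eval_pullback]
  exact hval (e y) hy _ (hc y p hp)

/-- A bijection which, in both directions, is given by linear substitutions of the Plücker
coordinates of each factor is an isomorphism of varieties. -/
def varietyIsoOfLinearChange [Fintype ι] (e : X ≃ Y)
    (c : ∀ j, (Fin (d' j) ↪o Fin N') → (Fin (d j) ↪o Fin N) → ℂ)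
    (c' : ∀ j, (Fin (d j) ↪o Fin N) → (Fin (d' j) ↪o Fin N') → ℂ)
    (hc : ∀ (x : X) p, IsPlucker (x : GrProd N d) p →
      IsPlucker (e x : GrProd N' d') (linearChange c p))
    (hc' : ∀ (y : Y) p, IsPlucker (y : GrProd N' d') p →
      IsPlucker (e.symm y : GrProd N d) (linearChange c' p)) :
    VarietyIso X Y where
  toHomeomorph :=
    { e with
      continuous_toFun := continuous_of_linearChange e c hc
      continuous_invFun := continuous_of_linearChange e.symm c' hc' }
  regularOn_iff := by
    intro W hW f
    set E : X ≃ₜ Y :=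
      { e with
        continuous_toFun := continuous_of_linearChange e c hc
        continuous_invFun := continuous_of_linearChange e.symm c' hc' } with hE
    refine ⟨fun hf => RegularOn.comp_linearChange E c hc hf, fun hf => ?_⟩
    have := RegularOn.comp_linearChange E.symm c' hc' hf
    rw [← Set.preimage_comp, Function.comp_assoc] at this
    simpa [Homeomorph.self_comp_symm] using this

end Criterion

/-- Composition of isomorphisms of varieties. -/
def VarietyIso.trans {N₁ N₂ N₃ : ℕ} {ι₁ ι₂ ι₃ : Type} [DecidableEq ι₁] [DecidableEq ι₂]
    [DecidableEq ι₃] {d₁ : ι₁ → ℕ} {d₂ : ι₂ → ℕ} {d₃ : ι₃ → ℕ} {X₁ : Set (GrProd N₁ d₁)}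
    {X₂ : Set (GrProd N₂ d₂)} {X₃ : Set (GrProd N₃ d₃)} (e : VarietyIso X₁ X₂)
    (e' : VarietyIso X₂ X₃) : VarietyIso X₁ X₃ where
  toHomeomorph := e.toHomeomorph.trans e'.toHomeomorph
  regularOn_iff := fun W hW f =>
    (e'.regularOn_iff W hW f).trans
      (e.regularOn_iff _ (hW.preimage e'.toHomeomorph.continuous) _)

end

section

/-! ### Orbits of the base change action -/

theorem alternatingMap_apply_eq_sum {N k : ℕ} (φ : (Fin N → ℂ) [⋀^Fin k]→ₗ[ℂ] ℂ)
    (b : Fin k → Fin N → ℂ) :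
    φ b = ∑ J : Fin k ↪o Fin N, φ (fun c => Pi.single (J c) 1) * minorMap J b := by
  conv_lhs => rw [alternatingMap_eq_sum_minorMap φ, sum_alternatingMap_apply]
  simp

variable {n : ℕ}

theorem orbit_symm {f f' : R n} (hf : f' ∈ orbit f) : f ∈ orbit f' := by
  obtain ⟨g, hg⟩ := hf
  refine ⟨fun j => (g j).symm, fun i => ?_⟩
  refine LinearMap.ext fun x => ?_
  simp [hg]

theorem orbit_trans {f f' f'' : R n} (h₁ : f' ∈ orbit f) (h₂ : f'' ∈ orbit f') :
    f'' ∈ orbit f := by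
  obtain ⟨g, hg⟩ := h₁
  obtain ⟨g', hg'⟩ := h₂
  refine ⟨fun j => (g j).trans (g' j), fun i => ?_⟩
  refine LinearMap.ext fun x => ?_
  simp [hg, hg']

/-- Translation of a point of the product of Grassmannians by automorphisms. -/
def baseChangePoint {N : ℕ} {ι : Type} {d : ι → ℕ}
    (g : ι → ((Fin N → ℂ) ≃ₗ[ℂ] (Fin N → ℂ))) (x : GrProd N d) : GrProd N d where
  space j := (x.space j).map (g j).toLinearMap
  finrank_space j := by
    rw [← x.finrank_space j]
    exact LinearEquiv.finrank_map_eq (g j) (x.space j)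

theorem isPlucker_baseChangePoint {N : ℕ} {ι : Type} {d : ι → ℕ}
    (g : ι → ((Fin N → ℂ) ≃ₗ[ℂ] (Fin N → ℂ))) {x : GrProd N d} {p : PluckerIndex N d → ℂ}
    (hp : IsPlucker x p) :
    IsPlucker (baseChangePoint g x)
      (linearChange (fun j I J => minorMap I fun c => g j (Pi.single (J c) 1)) p) := by
  rw [isPlucker_iff] at hp ⊢
  intro j
  obtain ⟨b, hb⟩ := hp j
  refine ⟨b.map ((g j).submoduleMap (x.space j)), fun I => ?_⟩
  have := alternatingMap_apply_eq_sum ((minorMap I).compLinearMap (g j).toLinearMap)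
    (fun c => (b c : Fin N → ℂ))
  simp only [AlternatingMap.compLinearMap_apply, LinearEquiv.coe_coe, ← hb] at this
  exact this.symm

theorem baseChangePoint_mem {f f' : R n} {g : Fin n → (V n ≃ₗ[ℂ] V n)}
    (hg : ∀ i, f' i = (g (tgt i)).toLinearMap ∘ₗ f i ∘ₗ (g (src i)).symm.toLinearMap)
    {x : GrProd (n + 1) fun j : Fin n => (j : ℕ) + 1} (hx : x ∈ linDegFlag f) :
    baseChangePoint g x ∈ linDegFlag f' := by
  intro i
  rintro _ ⟨_, ⟨v, hv, rfl⟩, rfl⟩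
  exact ⟨f i v, hx i ⟨v, hv, rfl⟩, by simp [hg]⟩

theorem baseChangePoint_symm {N : ℕ} {ι : Type} {d : ι → ℕ}
    (g : ι → ((Fin N → ℂ) ≃ₗ[ℂ] (Fin N → ℂ))) (x : GrProd N d) :
    baseChangePoint (fun j => (g j).symm) (baseChangePoint g x) = x := by
  ext j v
  simp [baseChangePoint]

theorem nonempty_varietyIso_of_baseChangePoint {N : ℕ} {ι : Type} {d : ι → ℕ} [Fintype ι]
    [DecidableEq ι] (g : ι → ((Fin N → ℂ) ≃ₗ[ℂ] (Fin N → ℂ))) {X Y : Set (GrProd N d)}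
    (h : ∀ x ∈ X, baseChangePoint g x ∈ Y)
    (h' : ∀ y ∈ Y, baseChangePoint (fun j => (g j).symm) y ∈ X) :
    Nonempty (VarietyIso X Y) := by
  have hsymm : ∀ x : GrProd N d,
      baseChangePoint g (baseChangePoint (fun j => (g j).symm) x) = x :=
    fun x => baseChangePoint_symm (fun j => (g j).symm) x
  let e : X ≃ Y :=
    { toFun := fun x => ⟨baseChangePoint g x, h x x.2⟩
      invFun := fun x => ⟨baseChangePoint (fun j => (g j).symm) x, h' x x.2⟩
      left_inv := fun x => Subtype.ext (baseChangePoint_symm g x.1)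
      right_inv := fun x => Subtype.ext (hsymm x.1) }
  exact ⟨varietyIsoOfLinearChange e _ _ (fun x p hp => isPlucker_baseChangePoint g hp)
    (fun x p hp => isPlucker_baseChangePoint (fun j => (g j).symm) hp)⟩

/-- Tuples in the same orbit have isomorphic linear degenerate flag varieties. -/
theorem nonempty_varietyIso_of_mem_orbit {f f' : R n} (hf : f' ∈ orbit f) :
    Nonempty (VarietyIso (linDegFlag f) (linDegFlag f')) := by
  obtain ⟨g, hg⟩ := hf
  refine nonempty_varietyIso_of_baseChangePoint g (fun x hx => baseChangePoint_mem hg hx)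
    fun x hx => baseChangePoint_mem (fun i => ?_) hx
  refine LinearMap.ext fun x => ?_
  simp [hg]

/-! ### Orbits of regular schemes -/

theorem exists_perm_comp_eq {α κ : Type*} [Finite α] {u v : κ → α}
    (hu : Function.Injective u) (hv : Function.Injective v) :
    ∃ σ : Equiv.Perm α, ∀ a, σ (u a) = v a := by
  classical
  have := Fintype.ofFinite α
  let E : {x // x ∈ Set.range u} ≃ {x // x ∈ Set.range v} :=
    (Equiv.ofInjective u hu).symm.trans (Equiv.ofInjective v hv)
  refine ⟨E.extendSubtype, fun a => ?_⟩
  rw [Equiv.extendSubtype_apply_of_mem E _ ⟨a, rfl⟩]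
  simp only [E, Equiv.trans_apply]
  rw [Equiv.ofInjective_symm_apply]
  rfl

/-- By regularity the nonzero entries of `b` and `b'` are two injective labellings of the same
arrows, so one permutation of the basis matches them. It can be used at every vertex because it
commutes with the identity maps. The bound on growth in a broken rhyme scheme plays no role here,
only that the entries name basis vectors. -/
theorem schemeMaps_mem_orbit {b b' : Fin (n - 1) → ℕ} (hb : IsRegularScheme b)
    (hb' : IsRegularScheme b') (hle : ∀ i, b i ≤ n + 1) (hle' : ∀ i, b' i ≤ n + 1)
    (hzero : ∀ i, b i = 0 ↔ b' i = 0) : schemeMaps b' ∈ orbit (schemeMaps b) := by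
  let u : {i // b i ≠ 0} → Fin (n + 1) := fun i => ⟨b i - 1, by have := hle i; have := i.2; omega⟩
  let v : {i // b i ≠ 0} → Fin (n + 1) := fun i => ⟨b' i - 1, by
    have := hle' i; have := (hzero i).not.mp i.2; omega⟩
  have hu : Function.Injective u := by
    intro i j hij
    by_contra hne
    have := hb i j (fun e => hne (Subtype.ext e)) i.2 j.2
    simp only [u, Fin.mk.injEq] at hij
    have := i.2; have := j.2
    omega
  have hv : Function.Injective v := by
    intro i j hij
    by_contra hne
    have h₁ := (hzero i).not.mp i.2
    have h₂ := (hzero j).not.mp j.2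
    have := hb' i j (fun e => hne (Subtype.ext e)) h₁ h₂
    simp only [v, Fin.mk.injEq] at hij
    omega
  obtain ⟨σ, hσ⟩ := exists_perm_comp_eq hu hv
  refine ⟨fun _ => LinearEquiv.funCongrLeft ℂ ℂ σ.symm, fun i => ?_⟩
  by_cases hi : b i = 0
  · have hi' := (hzero i).mp hi
    refine LinearMap.ext fun x => ?_
    funext l
    simp [schemeMaps, hi, hi', LinearMap.funLeft_apply]
  · have hi' := (hzero i).not.mp hi
    apply LinearMap.ext
    intro x
    funext l
    have hl : (l : ℕ) + 1 = b' i ↔ (σ.symm l : ℕ) + 1 = b i := by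
      have h₁ : (l : ℕ) + 1 = b' i ↔ l = v ⟨i, hi⟩ := by
        simp only [v, Fin.ext_iff]; omega
      have h₂ : (σ.symm l : ℕ) + 1 = b i ↔ σ.symm l = u ⟨i, hi⟩ := by
        simp only [u, Fin.ext_iff]; omega
      rw [h₁, h₂, Equiv.symm_apply_eq, hσ]
    simp only [schemeMaps, hi, hi', if_false, pr, LinearMap.pi_apply, LinearMap.comp_apply,
      LinearEquiv.coe_coe, LinearEquiv.funCongrLeft_apply, LinearMap.funLeft_apply, hl]
    split_ifs
    · rfl
    · simp [LinearEquiv.funCongrLeft, LinearMap.funLeft_apply]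

theorem IsBrokenRhymeScheme.le {m : ℕ} {b : Fin m → ℕ} (hb : IsBrokenRhymeScheme b) :
    ∀ i, b i ≤ (i : ℕ) + 1 := by
  intro i
  induction i using WellFoundedLT.induction with
  | ind i ih =>
    refine (hb i).trans (Nat.succ_le_succ (Finset.sup_le fun j hj => ?_))
    have hj : j < i := by simpa using hj
    exact (ih j hj).trans hj

/-- The scheme of the projection sequence of `I`: the entries of `I` are numbered in increasing
order. -/
def rankScheme (I : Finset (Fin (n - 1))) (i : Fin (n - 1)) : ℕ :=
  if i ∈ I then (I.filter (· < i)).card + 1 else 0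

theorem card_filter_lt_lt {m : ℕ} {I : Finset (Fin m)} {i j : Fin m} (hi : i ∈ I) (hij : i < j) :
    (I.filter (· < i)).card < (I.filter (· < j)).card := by
  apply Finset.card_lt_card
  rw [Finset.ssubset_iff_of_subset]
  · exact ⟨i, by simp [hi, hij], by simp⟩
  · intro k hk
    simp only [Finset.mem_filter] at hk ⊢
    exact ⟨hk.1, hk.2.trans hij⟩

theorem isRegularScheme_rankScheme (I : Finset (Fin (n - 1))) : IsRegularScheme (rankScheme I) := by
  intro i j hij hi hj
  simp only [rankScheme, ne_eq, ite_eq_right_iff, Nat.add_eq_zero_iff, one_ne_zero, and_false,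
    imp_false, not_not] at hi hj
  simp only [rankScheme, hi, hj, if_true, ne_eq, add_left_inj]
  rcases lt_or_gt_of_ne hij with hlt | hlt
  · exact (card_filter_lt_lt hi hlt).ne
  · exact (card_filter_lt_lt hj hlt).ne'

theorem isBrokenRhymeScheme_rankScheme (I : Finset (Fin (n - 1))) :
    IsBrokenRhymeScheme (rankScheme I) := by
  intro i
  by_cases hi : i ∈ I
  · simp only [rankScheme, hi, if_true, add_le_add_iff_right]
    by_cases hne : (I.filter (· < i)).Nonempty
    · obtain ⟨k, hk⟩ : ∃ k, k = (I.filter (· < i)).max' hne := ⟨_, rfl⟩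
      have hkm : k ∈ I.filter (· < i) := hk ▸ Finset.max'_mem _ _
      have hkI := Finset.mem_filter.mp hkm
      have hcard : (I.filter (· < i)).card = (I.filter (· < k)).card + 1 := by
        have : I.filter (· < i) = insert k (I.filter (· < k)) := by
          ext a
          simp only [Finset.mem_filter, Finset.mem_insert]
          constructor
          · intro ha
            have hak : a ≤ k := hk ▸ Finset.le_max' _ _ (Finset.mem_filter.mpr ha)
            rcases hak.eq_or_lt with h | h
            · exact Or.inl h
            · exact Or.inr ⟨ha.1, h⟩
          · rintro (rfl | ha)
            · exact hkI
            · exact ⟨ha.1, ha.2.trans hkI.2⟩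
        rw [this, Finset.card_insert_of_notMem (by simp)]
      have := Finset.le_sup (f := rankScheme I) (b := k)
        (s := Finset.univ.filter fun j => j < i) (by simpa using hkI.2)
      simp only [rankScheme, hkI.1, if_true] at this
      rw [hcard]
      exact this
    · rw [Finset.not_nonempty_iff_eq_empty.mp hne]
      simp
  · simp [rankScheme, hi]

/-- The projection sequence of `I` written as the maps of a sequence of integers. -/
def shiftScheme (I : Finset (Fin (n - 1))) (i : Fin (n - 1)) : ℕ :=
  if i ∈ I then (i : ℕ) + 2 else 0

theorem prSeq_eq_schemeMaps (I : Finset (Fin (n - 1))) : prSeq I = schemeMaps (shiftScheme I) := by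
  funext i
  by_cases hi : i ∈ I <;> simp [prSeq, schemeMaps, shiftScheme, hi]

theorem isRegularScheme_shiftScheme (I : Finset (Fin (n - 1))) :
    IsRegularScheme (shiftScheme I) := by
  intro i j hij hi hj
  have : (i : ℕ) ≠ j := fun e => hij (Fin.ext e)
  simp only [shiftScheme] at *
  split_ifs at * <;> omega

theorem shiftScheme_le (I : Finset (Fin (n - 1))) (i : Fin (n - 1)) : shiftScheme I i ≤ n + 1 := by
  simp only [shiftScheme]
  split_ifs <;> omega

/-- For nonempty `I` the entries `i + 2` of `shiftScheme I` grow too fast for a broken rhyme scheme;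
`rankScheme I` is one with the same zeros. -/
theorem prSeq_mem_pbwLocus (I : Finset (Fin (n - 1))) : prSeq I ∈ pbwLocus n := by
  refine ⟨rankScheme I, isBrokenRhymeScheme_rankScheme I, isRegularScheme_rankScheme I, ?_⟩
  rw [prSeq_eq_schemeMaps]
  refine schemeMaps_mem_orbit (isRegularScheme_rankScheme I) (isRegularScheme_shiftScheme I)
    (fun i => ?_) (shiftScheme_le I) fun i => ?_
  · have := (isBrokenRhymeScheme_rankScheme I).le i
    omega
  · by_cases hi : i ∈ I <;> simp [rankScheme, shiftScheme, hi]

theorem exists_mem_orbit_prSeq {f : R n} (hf : f ∈ pbwLocus n) :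
    ∃ I : Finset (Fin (n - 1)), f ∈ orbit (prSeq I) := by
  obtain ⟨b, hb, hb', hf⟩ := hf
  refine ⟨Finset.univ.filter fun i => b i ≠ 0, orbit_trans ?_ hf⟩
  rw [prSeq_eq_schemeMaps]
  refine schemeMaps_mem_orbit (isRegularScheme_shiftScheme _) hb' (shiftScheme_le _)
    (fun i => ?_) fun i => ?_
  · have := hb.le i
    omega
  · simp [shiftScheme]

/-- Base change composes each map with automorphisms, so injectivity of each single map is an
invariant. It is what separates the orbits. -/
theorem injective_iff_notMem_of_mem_orbit {f : R n} {I : Finset (Fin (n - 1))}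
    (hf : f ∈ orbit (prSeq I)) (i : Fin (n - 1)) : Function.Injective (f i) ↔ i ∉ I := by
  obtain ⟨g, hg⟩ := hf
  have : Function.Injective (f i) ↔ Function.Injective (prSeq I i) := by
    rw [hg]
    simp only [LinearMap.coe_comp, LinearEquiv.coe_coe]
    rw [EquivLike.comp_injective, EquivLike.injective_comp]
  rw [this]
  by_cases hi : i ∈ I
  · simp only [hi, not_true_eq_false, iff_false]
    intro hinj
    let k : Fin (n + 1) := ⟨i + 1, by omega⟩
    have h0 : prSeq I i (Pi.single k 1) = prSeq I i 0 := by
      funext l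
      by_cases hl : (l : ℕ) = i + 1
      · simp [prSeq, hi, pr, hl]
      · have : l ≠ k := fun e => hl (congrArg Fin.val e)
        simp [prSeq, hi, pr, hl, this]
    have := congrFun (hinj h0) k
    simp at this
  · simp [prSeq, hi, Function.injective_id]

theorem eq_of_mem_orbit_prSeq {f : R n} {I I' : Finset (Fin (n - 1))}
    (hI : f ∈ orbit (prSeq I)) (hI' : f ∈ orbit (prSeq I')) : I' = I := by
  ext i
  rw [← not_iff_not, ← injective_iff_notMem_of_mem_orbit hI,
    ← injective_iff_notMem_of_mem_orbit hI']

end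

section

/-! ### Coordinate subspaces -/

/-- The subspace of `ℂ^N` spanned by the first `k` basis vectors. -/
def stdSpace (N k : ℕ) : Submodule ℂ (Fin N → ℂ) where
  carrier := {v | ∀ i : Fin N, k ≤ i → v i = 0}
  add_mem' := fun hv hw i hi => by simp [hv i hi, hw i hi]
  zero_mem' := fun _ _ => rfl
  smul_mem' := fun c v hv i hi => by simp [hv i hi]

theorem mem_stdSpace {N k : ℕ} {v : Fin N → ℂ} :
    v ∈ stdSpace N k ↔ ∀ i : Fin N, k ≤ i → v i = 0 := Iff.rfl

theorem stdSpace_mono (N : ℕ) : Monotone (stdSpace N) :=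
  fun _ _ hkl _ hv i hi => hv i (hkl.trans hi)

theorem single_mem_stdSpace {N k : ℕ} {m : Fin N} (hm : (m : ℕ) < k) :
    (Pi.single m 1 : Fin N → ℂ) ∈ stdSpace N k := by
  intro i hi
  have : i ≠ m := by rintro rfl; omega
  simp [this]

theorem stdSpace_le_iff {N k : ℕ} {W : Submodule ℂ (Fin N → ℂ)} :
    stdSpace N k ≤ W ↔ ∀ m : Fin N, (m : ℕ) < k → (Pi.single m 1 : Fin N → ℂ) ∈ W := by
  refine ⟨fun h m hm => h (single_mem_stdSpace hm), fun h v hv => ?_⟩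
  rw [pi_eq_sum_univ' v]
  refine Submodule.sum_mem _ fun i _ => ?_
  by_cases hi : (i : ℕ) < k
  · refine W.smul_mem _ ?_
    have := h i hi
    convert this using 1
  · rw [hv i (not_lt.mp hi), zero_smul]
    exact W.zero_mem

theorem stdSpace_eq_range {N k : ℕ} (hk : k ≤ N) :
    stdSpace N k = LinearMap.range (Function.ExtendByZero.linearMap ℂ (Fin.castLE hk)) := by
  ext v
  simp only [mem_stdSpace, LinearMap.mem_range]
  constructor
  · intro hv
    refine ⟨fun a => v (Fin.castLE hk a), ?_⟩
    funext i
    by_cases hi : (i : ℕ) < k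
    · exact (Fin.castLE_injective hk).extend_apply (fun a => v (Fin.castLE hk a)) (0 : Fin N → ℂ) ⟨i, hi⟩
    · rw [hv i (not_lt.mp hi)]
      refine Function.extend_apply' (fun a => v (Fin.castLE hk a)) (0 : Fin N → ℂ) i ?_
      rintro ⟨a, rfl⟩
      exact hi a.2
  · rintro ⟨u, rfl⟩ i hi
    refine Function.extend_apply' _ _ _ ?_
    rintro ⟨a, rfl⟩
    exact absurd a.2 (not_lt.mpr hi)

theorem finrank_stdSpace {N k : ℕ} (hk : k ≤ N) : Module.finrank ℂ (stdSpace N k) = k := by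
  rw [stdSpace_eq_range hk, LinearMap.finrank_range_of_inj, Module.finrank_fin_fun]
  exact Function.extend_injective (Fin.castLE_injective hk) 0

theorem stdSpace_eq_top (N : ℕ) {k : ℕ} (hk : N ≤ k) : stdSpace N k = ⊤ := by
  rw [eq_top_iff]
  intro v _ i hi
  omega

/-! ### Subspaces between two coordinate subspaces -/

section Window

variable {N m h : ℕ} {τ : Fin m → Fin N}

/-- The subspace of `ℂ^N` between `ℂ^h` and `ℂ^{h+m}` corresponding to a subspace of the quotient,
which is identified with `ℂ^m` by `τ`. -/
def liftSpace (h : ℕ) (τ : Fin m → Fin N) (U : Submodule ℂ (Fin m → ℂ)) :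
    Submodule ℂ (Fin N → ℂ) :=
  stdSpace N (h + m) ⊓ U.comap (LinearMap.funLeft ℂ ℂ τ)

variable (hτ : Function.Injective τ) (hrange : ∀ x : Fin N, x ∈ Set.range τ ↔ h ≤ x ∧ (x : ℕ) < h + m)

include hrange in
theorem funLeft_eq_zero_iff {w : Fin N → ℂ} (hw : w ∈ stdSpace N (h + m)) :
    LinearMap.funLeft ℂ ℂ τ w = 0 ↔ w ∈ stdSpace N h := by
  constructor
  · intro h0 i hi
    by_cases hi' : (i : ℕ) < h + m
    · obtain ⟨l, rfl⟩ := (hrange i).mpr ⟨hi, hi'⟩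
      exact congrFun h0 l
    · exact hw i (not_lt.mp hi')
  · intro h0
    funext l
    exact h0 _ ((hrange _).mp ⟨l, rfl⟩).1

include hrange in
theorem extend_mem_stdSpace (v : Fin m → ℂ) :
    Function.ExtendByZero.linearMap ℂ τ v ∈ stdSpace N (h + m) := by
  intro i hi
  refine Function.extend_apply' _ _ _ fun hr => ?_
  have := ((hrange i).mp hr).2
  omega

include hτ in
theorem funLeft_extend (v : Fin m → ℂ) :
    LinearMap.funLeft ℂ ℂ τ (Function.ExtendByZero.linearMap ℂ τ v) = v := by
  funext l
  exact hτ.extend_apply _ _ l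

include hrange in
theorem stdSpace_le_liftSpace (U : Submodule ℂ (Fin m → ℂ)) :
    stdSpace N h ≤ liftSpace h τ U := by
  intro w hw
  have hw' := stdSpace_mono N (Nat.le_add_right h m) hw
  refine ⟨hw', ?_⟩
  rw [SetLike.mem_coe, Submodule.mem_comap, (funLeft_eq_zero_iff hrange hw').mpr hw]
  exact U.zero_mem

theorem liftSpace_le_stdSpace (U : Submodule ℂ (Fin m → ℂ)) :
    liftSpace h τ U ≤ stdSpace N (h + m) := inf_le_left

include hτ hrange in
theorem map_liftSpace (U : Submodule ℂ (Fin m → ℂ)) :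
    (liftSpace h τ U).map (LinearMap.funLeft ℂ ℂ τ) = U := by
  apply le_antisymm
  · rintro _ ⟨w, hw, rfl⟩
    exact hw.2
  · intro u hu
    refine ⟨Function.ExtendByZero.linearMap ℂ τ u, ⟨extend_mem_stdSpace hrange u, ?_⟩,
      funLeft_extend hτ u⟩
    rw [SetLike.mem_coe, Submodule.mem_comap, funLeft_extend hτ]
    exact hu

include hrange in
theorem liftSpace_map {W : Submodule ℂ (Fin N → ℂ)} (h₁ : stdSpace N h ≤ W)
    (h₂ : W ≤ stdSpace N (h + m)) :
    liftSpace h τ (W.map (LinearMap.funLeft ℂ ℂ τ)) = W := by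
  apply le_antisymm
  · rintro w ⟨hw, ⟨w', hw', heq⟩⟩
    have hsub : w - w' ∈ stdSpace N h := by
      rw [← funLeft_eq_zero_iff hrange (Submodule.sub_mem _ hw (h₂ hw')), map_sub, heq, sub_self]
    have := W.add_mem (h₁ hsub) hw'
    rwa [sub_add_cancel] at this
  · exact fun w hw => ⟨h₂ hw, ⟨w, hw, rfl⟩⟩

include hrange in
theorem finrank_eq_add_finrank_map {W : Submodule ℂ (Fin N → ℂ)} (hN : h ≤ N)
    (h₁ : stdSpace N h ≤ W) (h₂ : W ≤ stdSpace N (h + m)) :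
    Module.finrank ℂ W = h + Module.finrank ℂ (W.map (LinearMap.funLeft ℂ ℂ τ)) := by
  have := LinearMap.finrank_range_add_finrank_ker ((LinearMap.funLeft ℂ ℂ τ).domRestrict W)
  rw [LinearMap.range_domRestrict] at this
  have hker : Module.finrank ℂ (LinearMap.ker ((LinearMap.funLeft ℂ ℂ τ).domRestrict W)) = h := by
    have hmap : (LinearMap.ker ((LinearMap.funLeft ℂ ℂ τ).domRestrict W)).map W.subtype =
        stdSpace N h := by
      ext w
      simp only [Submodule.mem_map, LinearMap.mem_ker, Submodule.subtype_apply, Subtype.exists,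
        LinearMap.domRestrict_apply]
      constructor
      · rintro ⟨a, ha, h0, rfl⟩
        exact (funLeft_eq_zero_iff hrange (h₂ ha)).mp h0
      · intro hw
        exact ⟨w, h₁ hw, (funLeft_eq_zero_iff hrange (h₂ (h₁ hw))).mpr hw, rfl⟩
    rw [← Submodule.finrank_map_subtype_eq W, hmap, finrank_stdSpace hN]
  omega

/-- The first `h` basis vectors of `ℂ^N`, followed by the images of the given vectors. -/
def extendVectors (hN : h ≤ N) (τ : Fin m → Fin N) {k : ℕ} (b : Fin k → Fin m → ℂ) :
    Fin (h + k) → Fin N → ℂ :=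
  Fin.append (fun a => Pi.single (Fin.castLE hN a) 1)
    fun c => Function.ExtendByZero.linearMap ℂ τ (b c)

theorem extendVectors_update (hN : h ≤ N) {k : ℕ} (b : Fin k → Fin m → ℂ) (i : Fin k)
    (x : Fin m → ℂ) :
    extendVectors hN τ (Function.update b i x) =
      Function.update (extendVectors hN τ b) (Fin.natAdd h i)
        (Function.ExtendByZero.linearMap ℂ τ x) := by
  funext c
  refine Fin.addCases (fun a => ?_) (fun a => ?_) c
  · have : Fin.castAdd k a ≠ Fin.natAdd h i := by
      intro e
      have := congrArg Fin.val e
      simp at this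
      omega
    simp only [extendVectors, Fin.append_left, Function.update_of_ne this]
  · by_cases ha : a = i
    · subst ha
      simp [extendVectors]
    · have : Fin.natAdd h a ≠ Fin.natAdd h i := by simpa using ha
      simp only [extendVectors, Fin.append_right, Function.update_of_ne this,
        Function.update_of_ne ha]

/-- A minor of `extendVectors b` as an alternating function of `b`. -/
def extendMinor (hN : h ≤ N) (τ : Fin m → Fin N) {k : ℕ} (J : Fin (h + k) → Fin N) :
    (Fin m → ℂ) [⋀^Fin k]→ₗ[ℂ] ℂ where
  toFun b := minorMap J (extendVectors hN τ b)
  map_update_add' := by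
    intro inst b i x y
    rw [Subsingleton.elim inst (instDecidableEqFin k)]
    simp only [extendVectors_update, map_add, AlternatingMap.map_update_add]
  map_update_smul' := by
    intro inst b i r x
    rw [Subsingleton.elim inst (instDecidableEqFin k)]
    simp only [extendVectors_update, map_smul, AlternatingMap.map_update_smul]
  map_eq_zero_of_eq' := by
    intro b i j hij hne
    refine (minorMap J).map_eq_zero_of_eq _ (i := Fin.natAdd h i) (j := Fin.natAdd h j) ?_
      (by simpa using hne)
    simp [extendVectors, hij]

-- On these rows the matrix is block diagonal, with an identity block of size `h`. The rows need not
-- be increasing, since `τ` need not be monotone; this is why `minorMap` admits arbitrary row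
-- sequences.
include hτ hrange in
theorem minorMap_extendVectors (hN : h ≤ N) {k : ℕ} (I : Fin k → Fin m) (b : Fin k → Fin m → ℂ) :
    minorMap (Fin.append (Fin.castLE hN) (τ ∘ I)) (extendVectors hN τ b) = minorMap I b := by
  rw [minorMap_apply, minorMap_apply, ← Matrix.det_submatrix_equiv_self finSumFinEquiv]
  have : (Matrix.of fun r c => extendVectors hN τ b c
      (Fin.append (Fin.castLE hN) (τ ∘ I) r)).submatrix finSumFinEquiv finSumFinEquiv =
      Matrix.fromBlocks (1 : Matrix (Fin h) (Fin h) ℂ) 0 0 (Matrix.of fun r c => b c (I r)) := by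
    have hnot : ∀ a : Fin h, Fin.castLE hN a ∉ Set.range τ := fun a ha => by
      have := ((hrange _).mp ha).1
      simp at this
      omega
    ext r c
    rcases r with r | r <;> rcases c with c | c
    · simp [extendVectors, Pi.single_apply, Matrix.one_apply]
    · simp only [Matrix.submatrix_apply, Matrix.of_apply, finSumFinEquiv_apply_left,
        finSumFinEquiv_apply_right, extendVectors, Fin.append_left, Fin.append_right,
        Matrix.fromBlocks_apply₁₂, Matrix.zero_apply]
      exact Function.extend_apply' _ _ _ (hnot r)
    · have : τ (I r) ≠ Fin.castLE hN c := fun e => hnot c ⟨_, e⟩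
      simp [extendVectors, this]
    · simp only [Matrix.submatrix_apply, Matrix.of_apply, finSumFinEquiv_apply_right,
        extendVectors, Fin.append_right, Matrix.fromBlocks_apply₂₂]
      exact hτ.extend_apply _ _ _
  rw [this, Matrix.det_fromBlocks_zero₂₁, Matrix.det_one, one_mul]

include hτ hrange in
theorem exists_basis_liftSpace (hN : h ≤ N) {k : ℕ} {U : Submodule ℂ (Fin m → ℂ)}
    (b : Module.Basis (Fin k) ℂ U) :
    ∃ b' : Module.Basis (Fin (h + k)) ℂ (liftSpace h τ U),
      ∀ c, (b' c : Fin N → ℂ) = extendVectors hN τ (fun c => (b c : Fin m → ℂ)) c := by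
  have hmem : ∀ c, extendVectors hN τ (fun c => (b c : Fin m → ℂ)) c ∈ liftSpace h τ U := by
    intro c
    refine Fin.addCases (fun a => ?_) (fun a => ?_) c
    · simp only [extendVectors, Fin.append_left]
      exact stdSpace_le_liftSpace hrange U (single_mem_stdSpace a.2)
    · simp only [extendVectors, Fin.append_right]
      refine ⟨extend_mem_stdSpace hrange _, ?_⟩
      rw [SetLike.mem_coe, Submodule.mem_comap, funLeft_extend hτ]
      exact (b a).2
  have hrank : Fintype.card (Fin (h + k)) = Module.finrank ℂ (liftSpace h τ U) := by
    rw [finrank_eq_add_finrank_map hrange hN (stdSpace_le_liftSpace hrange U)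
      (liftSpace_le_stdSpace U), map_liftSpace hτ hrange, Module.finrank_eq_card_basis b]
    simp
  have hspan : ⊤ ≤ Submodule.span ℂ (Set.range fun c =>
      (⟨extendVectors hN τ (fun c => (b c : Fin m → ℂ)) c, hmem c⟩ : liftSpace h τ U)) := by
    rw [← Submodule.map_le_map_iff_of_injective (liftSpace h τ U).injective_subtype,
      Submodule.map_span, ← Set.range_comp, Submodule.map_top, Submodule.range_subtype]
    set S := Submodule.span ℂ (Set.range ((liftSpace h τ U).subtype ∘ fun c =>
      (⟨extendVectors hN τ (fun c => (b c : Fin m → ℂ)) c, hmem c⟩ : liftSpace h τ U))) with hS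
    have hvec : ∀ c, extendVectors hN τ (fun c => (b c : Fin m → ℂ)) c ∈ S :=
      fun c => Submodule.subset_span ⟨c, rfl⟩
    have hstd : stdSpace N h ≤ S := by
      rw [stdSpace_le_iff]
      intro a ha
      have := hvec (Fin.castAdd k ⟨a, ha⟩)
      rw [extendVectors, Fin.append_left] at this
      exact this
    -- The span lies between `ℂ^h` and `ℂ^{h+m}`, so it is determined by its image in `ℂ^m`; it
    -- remains to see that this image contains `U`.
    rw [← liftSpace_map hrange (W := S) hstd]
    · refine inf_le_inf le_rfl (Submodule.comap_mono ?_)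
      intro u hu
      have hb : (⟨u, hu⟩ : U) ∈ Submodule.span ℂ (Set.range b) := by
        rw [b.span_eq]
        trivial
      have : u ∈ Submodule.span ℂ (Set.range fun c => (b c : Fin m → ℂ)) := by
        have := Submodule.mem_map_of_mem (f := U.subtype) hb
        rw [Submodule.map_span, ← Set.range_comp] at this
        exact this
      refine Submodule.span_le.mpr ?_ this
      rintro _ ⟨c, rfl⟩
      refine ⟨_, hvec (Fin.natAdd h c), ?_⟩
      simp only [extendVectors, Fin.append_right]
      exact funLeft_extend hτ _
    · rw [hS]
      refine Submodule.span_le.mpr ?_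
      rintro _ ⟨c, rfl⟩
      exact (hmem c).1
  refine ⟨basisOfTopLeSpanOfCardEqFinrank _ hspan hrank, fun c => ?_⟩
  rw [coe_basisOfTopLeSpanOfCardEqFinrank]

end Window

end

section

/-! ### The flags between two chains of coordinate subspaces -/

variable {n : ℕ}

/-- The partial flags `W` in `ℂ^{n+1+d}` with `ℂ^{h_j} ⊆ W_j ⊆ ℂ^{h_j+n+1}` for all `j`. -/
def windowFlags (I : Finset (Fin (n - 1))) : Set (GrProd (n + I.card + 1) (ell I)) :=
  {W | Monotone W.space ∧ ∀ j, stdSpace _ (h I j) ≤ W.space j ∧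
    W.space j ≤ stdSpace _ (h I j + (n + 1))}

theorem h_tgt_of_mem {I : Finset (Fin (n - 1))} {i : Fin (n - 1)} (hi : i ∈ I) :
    h I (tgt i) = h I (src i) + 1 := by
  have : (I.filter fun k : Fin (n - 1) => (k : ℕ) < (tgt i : Fin n)) =
      insert i (I.filter fun k : Fin (n - 1) => (k : ℕ) < (src i : Fin n)) := by
    ext k
    rw [Finset.mem_insert, Finset.mem_filter, Finset.mem_filter, Fin.ext_iff]
    simp only [tgt, src]
    constructor
    · rintro ⟨hk, hlt⟩
      by_cases h : (k : ℕ) = i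
      · exact Or.inl h
      · exact Or.inr ⟨hk, by omega⟩
    · rintro (h | ⟨hk, hlt⟩)
      · rw [Fin.ext h]
        exact ⟨hi, by omega⟩
      · exact ⟨hk, by omega⟩
  rw [h, this, Finset.card_insert_of_notMem (by simp [src]), h]

theorem h_tgt_of_notMem {I : Finset (Fin (n - 1))} {i : Fin (n - 1)} (hi : i ∉ I) :
    h I (tgt i) = h I (src i) := by
  unfold h
  congr 1
  apply Finset.filter_congr
  intro k hk
  have : (k : ℕ) ≠ i := fun e => hi (Fin.ext e ▸ hk)
  simp only [tgt, src]
  omega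

theorem monotone_of_src_le_tgt {α : Type*} [Preorder α] {W : Fin n → α}
    (hW : ∀ i : Fin (n - 1), W (src i) ≤ W (tgt i)) : Monotone W := by
  have key : ∀ (k a : ℕ) (ha : a + k < n), W ⟨a, by omega⟩ ≤ W ⟨a + k, ha⟩ := by
    intro k
    induction k with
    | zero => exact fun a ha => le_rfl
    | succ k ih => exact fun a ha => (ih a (by omega)).trans (hW ⟨a + k, by omega⟩)
  intro i j hij
  obtain ⟨k, hk⟩ := Nat.exists_eq_add_of_le (Fin.le_iff_val_le_val.mp hij)
  have hj : j = ⟨i + k, by omega⟩ := Fin.ext hk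
  rw [hj]
  exact key k i _

theorem exists_windowPerm (I : Finset (Fin (n - 1))) :
    ∃ ρ : Equiv.Perm (Fin (n + 1)), ∀ i ∈ I, ∀ l : Fin (n + 1), (l : ℕ) = i + 1 →
      (ρ l : ℕ) = h I (src i) := by
  let u : I → Fin (n + 1) := fun i => ⟨i.1 + 1, by omega⟩
  let v : I → Fin (n + 1) := fun i => ⟨h I (src i.1), by
    have := h_le I (src i.1); have := I.card_le_univ; rw [Fintype.card_fin] at this; omega⟩
  have hu : Function.Injective u := by
    intro i j hij
    simp only [u, Fin.mk.injEq] at hij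
    exact Subtype.ext (Fin.ext (by omega))
  have hlt : ∀ i j : I, i < j → h I (src i.1) < h I (src j.1) := fun i j hij =>
    card_filter_lt_lt i.2 hij
  have hv : Function.Injective v := by
    intro i j hij
    simp only [v, Fin.mk.injEq] at hij
    rcases lt_trichotomy i j with hl | hl | hl
    · exact absurd hij (hlt i j hl).ne
    · exact hl
    · exact absurd hij (hlt j i hl).ne'
  obtain ⟨σ, hσ⟩ := exists_perm_comp_eq hu hv
  refine ⟨σ, fun i hi l hl => ?_⟩
  have := hσ ⟨i, hi⟩
  have hlu : l = u ⟨i, hi⟩ := Fin.ext hl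
  rw [hlu, this]

/-- A numbering of the basis of `V` such that, for `i ∈ I`, the vector killed by the `i`-th
projection has number `h_i`. -/
def windowPerm (I : Finset (Fin (n - 1))) : Equiv.Perm (Fin (n + 1)) :=
  (exists_windowPerm I).choose

theorem windowPerm_spec {I : Finset (Fin (n - 1))} {i : Fin (n - 1)} (hi : i ∈ I)
    {l : Fin (n + 1)} (hl : (l : ℕ) = i + 1) : (windowPerm I l : ℕ) = h I (src i) :=
  (exists_windowPerm I).choose_spec i hi l hl

/-- The identification of the basis of `V` with the basis vectors of `ℂ^{n+1+d}` of index
`h_j, …, h_j + n`. -/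
def windowIndex (I : Finset (Fin (n - 1))) (j : Fin n) (l : Fin (n + 1)) :
    Fin (n + I.card + 1) :=
  if hl : h I j ≤ windowPerm I l then ⟨windowPerm I l, by omega⟩
  else ⟨windowPerm I l + (n + 1), by have := h_le I j; omega⟩

theorem windowIndex_val (I : Finset (Fin (n - 1))) (j : Fin n) (l : Fin (n + 1)) :
    (windowIndex I j l : ℕ) =
      if h I j ≤ windowPerm I l then (windowPerm I l : ℕ) else windowPerm I l + (n + 1) := by
  unfold windowIndex
  split_ifs <;> rfl

theorem windowIndex_injective (I : Finset (Fin (n - 1))) (j : Fin n) :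
    Function.Injective (windowIndex I j) := by
  intro l l' hll
  have h₁ := congrArg Fin.val hll
  rw [windowIndex_val, windowIndex_val] at h₁
  apply (windowPerm I).injective
  apply Fin.ext
  split_ifs at h₁ <;> omega

theorem mem_range_windowIndex (I : Finset (Fin (n - 1))) (j : Fin n) (x : Fin (n + I.card + 1)) :
    x ∈ Set.range (windowIndex I j) ↔ h I j ≤ x ∧ (x : ℕ) < h I j + (n + 1) := by
  have hd := h_le I j
  have hc := I.card_le_univ
  rw [Fintype.card_fin] at hc
  constructor
  · rintro ⟨l, rfl⟩
    rw [windowIndex_val]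
    have := (windowPerm I l).2
    split_ifs <;> omega
  · rintro ⟨h₁, h₂⟩
    by_cases hx : (x : ℕ) < n + 1
    · refine ⟨(windowPerm I).symm ⟨x, hx⟩, Fin.ext ?_⟩
      rw [windowIndex_val]
      simp [h₁]
    · refine ⟨(windowPerm I).symm ⟨x - (n + 1), by omega⟩, Fin.ext ?_⟩
      rw [windowIndex_val]
      simp only [Equiv.apply_symm_apply]
      rw [if_neg (by omega)]
      omega

/-- The projection from `ℂ^{n+1+d}` to `V` at the vertex `j`. -/
abbrev windowProj (I : Finset (Fin (n - 1))) (j : Fin n) :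
    (Fin (n + I.card + 1) → ℂ) →ₗ[ℂ] V n :=
  LinearMap.funLeft ℂ ℂ (windowIndex I j)

/-- For `i ∈ I` only the label of the basis vector `h_i` changes its representative, to `h_i + n +
1`. That index is outside the source window, so the coordinate of `w` there vanishes, as the
projection demands. All other labels keep their index. -/
theorem windowProj_tgt (I : Finset (Fin (n - 1))) (i : Fin (n - 1))
    {w : Fin (n + I.card + 1) → ℂ} (hw : w ∈ stdSpace _ (h I (src i) + (n + 1))) :
    windowProj I (tgt i) w = prSeq I i (windowProj I (src i) w) := by
  by_cases hi : i ∈ I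
  · funext l
    have ht := h_tgt_of_mem hi
    simp only [prSeq, hi, if_true, pr, LinearMap.pi_apply, LinearMap.funLeft_apply]
    by_cases hl : (l : ℕ) = i + 1
    · rw [if_pos (by omega)]
      refine hw _ ?_
      rw [windowIndex_val, windowPerm_spec hi hl, ht, if_neg (by omega)]
    · rw [if_neg (by omega)]
      simp only [LinearMap.proj_apply, LinearMap.funLeft_apply]
      congr 1
      apply Fin.ext
      have hne : (windowPerm I l : ℕ) ≠ h I (src i) := by
        have hk := windowPerm_spec hi (l := ⟨i + 1, by omega⟩) rfl
        intro e
        have : windowPerm I l = windowPerm I ⟨i + 1, by omega⟩ := Fin.ext (e.trans hk.symm)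
        exact hl (congrArg Fin.val ((windowPerm I).injective this))
      rw [windowIndex_val, windowIndex_val, ht]
      split_ifs <;> omega
  · have ht := h_tgt_of_notMem hi
    have : windowIndex I (tgt i) = windowIndex I (src i) := by
      funext l
      apply Fin.ext
      rw [windowIndex_val, windowIndex_val, ht]
    simp only [prSeq, hi, if_false, LinearMap.id_apply, windowProj, this]

theorem h_le_dim (I : Finset (Fin (n - 1))) (j : Fin n) : h I j ≤ n + I.card + 1 := by
  have := h_le I j
  omega

/-- The tuple of subspaces of `ℂ^{n+1+d}` corresponding to a tuple of subspaces of `V`. -/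
def liftPoint (I : Finset (Fin (n - 1))) (U : GrProd (n + 1) fun j : Fin n => (j : ℕ) + 1) :
    GrProd (n + I.card + 1) (ell I) where
  space j := liftSpace (h I j) (windowIndex I j) (U.space j)
  finrank_space j := by
    have hr := mem_range_windowIndex I j
    rw [finrank_eq_add_finrank_map hr (h_le_dim I j) (stdSpace_le_liftSpace hr _)
      (liftSpace_le_stdSpace _), map_liftSpace (windowIndex_injective I j) hr,
      U.finrank_space, ell]

theorem liftPoint_mem {I : Finset (Fin (n - 1))}
    {U : GrProd (n + 1) fun j : Fin n => (j : ℕ) + 1} (hU : U ∈ linDegFlag (prSeq I)) :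
    liftPoint I U ∈ windowFlags I := by
  refine ⟨monotone_of_src_le_tgt fun i => ?_, fun j =>
    ⟨stdSpace_le_liftSpace (mem_range_windowIndex I j) _, liftSpace_le_stdSpace _⟩⟩
  rintro w ⟨hw, hwU⟩
  refine ⟨stdSpace_mono _ ?_ hw, ?_⟩
  · by_cases hi : i ∈ I
    · rw [h_tgt_of_mem hi]; omega
    · rw [h_tgt_of_notMem hi]
  · rw [SetLike.mem_coe, Submodule.mem_comap]
    change windowProj I (tgt i) w ∈ _
    rw [windowProj_tgt I i hw]
    exact hU i ⟨_, hwU, rfl⟩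

/-- The tuple of subspaces of `V` corresponding to a flag in `ℂ^{n+1+d}`. -/
def projPoint (I : Finset (Fin (n - 1))) (W : windowFlags I) :
    GrProd (n + 1) fun j : Fin n => (j : ℕ) + 1 where
  space j := (W.1.space j).map (windowProj I j)
  finrank_space j := by
    have := finrank_eq_add_finrank_map (mem_range_windowIndex I j) (h_le_dim I j)
      (W.2.2 j).1 (W.2.2 j).2
    rw [W.1.finrank_space, ell] at this
    exact (Nat.add_left_cancel this).symm

theorem projPoint_mem (I : Finset (Fin (n - 1))) (W : windowFlags I) :
    projPoint I W ∈ linDegFlag (prSeq I) := by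
  rintro i _ ⟨_, ⟨w, hw, rfl⟩, rfl⟩
  rw [← windowProj_tgt I i ((W.2.2 _).2 hw)]
  refine ⟨w, W.2.1 ?_ hw, rfl⟩
  simp [src, tgt, Fin.le_iff_val_le_val]

/-- The bijection between the degenerate flag variety of a projection sequence and the variety of
flags between two chains of coordinate subspaces. -/
def windowEquiv (I : Finset (Fin (n - 1))) : linDegFlag (prSeq I) ≃ windowFlags I where
  toFun U := ⟨liftPoint I U.1, liftPoint_mem U.2⟩
  invFun W := ⟨projPoint I W, projPoint_mem I W⟩
  left_inv U := by
    apply Subtype.ext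
    apply GrProd.ext
    funext j
    exact map_liftSpace (windowIndex_injective I j) (mem_range_windowIndex I j) _
  right_inv W := by
    apply Subtype.ext
    apply GrProd.ext
    funext j
    exact liftSpace_map (mem_range_windowIndex I j) (W.2.2 j).1 (W.2.2 j).2

/-- Coefficients expressing Plücker coordinates of `liftPoint U` by those of `U`. -/
def liftCoeff (I : Finset (Fin (n - 1))) (j : Fin n) (J : Fin (ell I j) ↪o Fin (n + I.card + 1))
    (K : Fin ((j : ℕ) + 1) ↪o Fin (n + 1)) : ℂ :=
  extendMinor (h_le_dim I j) (windowIndex I j) (k := (j : ℕ) + 1) J fun c => Pi.single (K c) 1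

/-- Coefficients expressing Plücker coordinates of `U` by those of `liftPoint U`. -/
def projCoeff (I : Finset (Fin (n - 1))) (j : Fin n) (K : Fin ((j : ℕ) + 1) ↪o Fin (n + 1))
    (J : Fin (ell I j) ↪o Fin (n + I.card + 1)) : ℂ :=
  minorMap (Fin.append (Fin.castLE (h_le_dim I j)) (windowIndex I j ∘ K))
    fun c => Pi.single (J c) 1

/-- Minors of the lifted basis are alternating functions of the original basis, hence linear in its
minors. The block-diagonal minors recover the original coordinates exactly, not merely up to
scalars. -/
theorem isPlucker_liftPoint (I : Finset (Fin (n - 1)))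
    {U : GrProd (n + 1) fun j : Fin n => (j : ℕ) + 1}
    {p : PluckerIndex (n + 1) (fun j : Fin n => (j : ℕ) + 1) → ℂ} (hp : IsPlucker U p) :
    IsPlucker (liftPoint I U) (linearChange (liftCoeff I) p) ∧
      linearChange (projCoeff I) (linearChange (liftCoeff I) p) = p := by
  rw [isPlucker_iff] at hp
  choose b hb using hp
  have key : ∀ (j : Fin n) (J : Fin (ell I j) ↪o Fin (n + I.card + 1)),
      linearChange (liftCoeff I) p ⟨j, J⟩ = minorMap (k := h I j + ((j : ℕ) + 1)) J
        (extendVectors (h_le_dim I j) (windowIndex I j) fun c => (b j c : V n)) := by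
    intro j J
    have := alternatingMap_apply_eq_sum
      (extendMinor (h_le_dim I j) (windowIndex I j) (k := (j : ℕ) + 1) J)
      (fun c => (b j c : V n))
    simp only [← hb] at this
    exact this.symm
  constructor
  · rw [isPlucker_iff]
    intro j
    obtain ⟨b', hb'⟩ := exists_basis_liftSpace (windowIndex_injective I j)
      (mem_range_windowIndex I j) (h_le_dim I j) (b j)
    refine ⟨b', fun J => ?_⟩
    rw [key]
    congr 1
    funext c
    exact (hb' c).symm
  · funext ⟨j, K⟩
    rw [hb, ← minorMap_extendVectors (windowIndex_injective I j) (mem_range_windowIndex I j)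
      (h_le_dim I j), alternatingMap_apply_eq_sum]
    refine Finset.sum_congr rfl fun J _ => ?_
    exact congrArg _ (key j J)

theorem linearChange_smul {N N' : ℕ} {ι : Type} {d d' : ι → ℕ}
    (c : ∀ j, (Fin (d' j) ↪o Fin N') → (Fin (d j) ↪o Fin N) → ℂ) (a : ι → ℂ)
    (p : PluckerIndex N d → ℂ) :
    linearChange c (fun q => a q.1 * p q) = fun q => a q.1 * linearChange c p q := by
  funext q
  simp only [linearChange, Finset.mul_sum]
  exact Finset.sum_congr rfl fun I _ => by ring

/-- The degenerate flag variety of a projection sequence is isomorphic to the variety of flags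
between two chains of coordinate subspaces. -/
def windowIso (I : Finset (Fin (n - 1))) :
    VarietyIso (linDegFlag (prSeq I)) (windowFlags I) :=
  varietyIsoOfLinearChange (windowEquiv I) (liftCoeff I) (projCoeff I)
    (fun U p hp => (isPlucker_liftPoint I hp).1) fun W p hp => by
      obtain ⟨U, rfl⟩ := (windowEquiv I).surjective W
      rw [Equiv.symm_apply_apply]
      -- An arbitrary system `p` for the lifted flag is a rescaling of the one lifted from `q`, and
      -- `projCoeff` inverts the latter.
      obtain ⟨q, hq⟩ := exists_isPlucker U.1
      obtain ⟨hq', hqq⟩ := isPlucker_liftPoint I hq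
      obtain ⟨a, ha, rfl⟩ := IsPlucker.exists_scale hq' hp
      rw [linearChange_smul, hqq]
      exact hq.scale (fun j => Nat.succ_pos _) ha

end

section

/-! ### Closed conditions -/

/-- Hypothesis `ht` says that the rows in `t` span: a functional killing them is zero. The
independent rows in `s` then extend to a basis of row vectors chosen from `t`, and that basis is the
required `J`. -/
theorem exists_minorMap_ne_zero {N k : ℕ} {b : Fin k → Fin N → ℂ} {s t : Set (Fin N)}
    (hst : s ⊆ t) (hs : LinearIndepOn ℂ (fun i (c : Fin k) => b c i) s)
    (ht : ∀ a : Fin k → ℂ, (∀ i ∈ t, ∑ c, a c * b c i = 0) → a = 0) :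
    ∃ J : Fin k ↪o Fin N, s ⊆ Set.range J ∧ Set.range J ⊆ t ∧ minorMap J b ≠ 0 := by
  classical
  set row : Fin N → Fin k → ℂ := fun i c => b c i with hrow
  obtain ⟨B, hBt, hsB, hspan, hB⟩ := exists_linearIndepOn_extension hs hst
  have htop : Submodule.span ℂ (row '' B) = ⊤ := by
    by_contra hne
    obtain ⟨f, hf, hle⟩ := Submodule.exists_le_ker_of_lt_top _ (lt_top_iff_ne_top.mpr hne)
    have hfsum : ∀ v : Fin k → ℂ, f v = ∑ c, f (Pi.single c 1) * v c := by
      intro v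
      conv_lhs => rw [pi_eq_sum_univ v, map_sum]
      refine Finset.sum_congr rfl fun c _ => ?_
      rw [map_smul, smul_eq_mul, mul_comm]
      congr 2
      funext c'
      simp [Pi.single_apply, eq_comm]
    have hz := ht (fun c => f (Pi.single c 1)) fun i hi => by
      have := hle (hspan ⟨i, hi, rfl⟩)
      rw [LinearMap.mem_ker, hfsum] at this
      exact this
    apply hf
    refine LinearMap.ext fun v => ?_
    rw [hfsum, LinearMap.zero_apply]
    exact Finset.sum_eq_zero fun c _ => by rw [congrFun hz c]; simp
  have hcard : B.toFinset.card = k := by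
    have hspan' : ⊤ ≤ Submodule.span ℂ (Set.range fun i : B => row i) := by
      rw [← Set.image_eq_range, htop]
    have := Module.finrank_eq_card_basis (Module.Basis.mk hB hspan')
    rw [Module.finrank_fin_fun] at this
    rw [Set.toFinset_card, this]
  refine ⟨B.toFinset.orderEmbOfFin hcard, ?_, ?_, ?_⟩
  · rw [Finset.range_orderEmbOfFin, Set.coe_toFinset]
    exact hsB
  · rw [Finset.range_orderEmbOfFin, Set.coe_toFinset]
    exact hBt
  · rw [minorMap_apply, ← isUnit_iff_ne_zero, ← Matrix.isUnit_iff_isUnit_det,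
      ← Matrix.linearIndependent_rows_iff_isUnit]
    have hmem : ∀ r, B.toFinset.orderEmbOfFin hcard r ∈ B := fun r => by
      exact Set.mem_toFinset.mp (Finset.orderEmbOfFin_mem B.toFinset hcard r)
    refine LinearIndependent.comp hB (fun r => ⟨B.toFinset.orderEmbOfFin hcard r, hmem r⟩) ?_
    intro r r' h
    have h' := congrArg Subtype.val h
    exact (B.toFinset.orderEmbOfFin hcard).injective h'

/-! ### Position relative to coordinate subspaces, detected by minors -/

section Vanishing

variable {N k : ℕ} {W : Submodule ℂ (Fin N → ℂ)} (b : Module.Basis (Fin k) ℂ W)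

theorem exists_coeff {v : Fin N → ℂ} (hv : v ∈ W) :
    ∃ a : Fin k → ℂ, ∀ i, v i = ∑ c, a c * (b c : Fin N → ℂ) i := by
  refine ⟨fun c => b.repr ⟨v, hv⟩ c, fun i => ?_⟩
  have := congrFun (congrArg W.subtype (b.sum_repr ⟨v, hv⟩)) i
  rw [map_sum, Finset.sum_apply] at this
  exact this.symm

theorem sum_mem_of_basis (a : Fin k → ℂ) :
    (fun i => ∑ c, a c * (b c : Fin N → ℂ) i) ∈ W := by
  have : (fun i => ∑ c, a c * (b c : Fin N → ℂ) i) = ∑ c, a c • (b c : Fin N → ℂ) := by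
    funext i
    simp
  rw [this]
  exact Submodule.sum_mem _ fun c _ => W.smul_mem _ (b c).2

theorem coeff_eq_zero {a : Fin k → ℂ} (h : ∀ i, ∑ c, a c * (b c : Fin N → ℂ) i = 0) : a = 0 := by
  have hli := b.linearIndependent.map' W.subtype (Submodule.ker_subtype W)
  rw [Fintype.linearIndependent_iff] at hli
  funext c
  refine hli a ?_ c
  funext i
  simpa using h i

/-- Deleting the coordinate `m` kills the vector `e_m` of `W`, so the square submatrix on `J` has a
nontrivial kernel. -/
theorem minorMap_eq_zero_of_single_mem {m : Fin N} (hm : (Pi.single m 1 : Fin N → ℂ) ∈ W)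
    {J : Fin k → Fin N} (hJ : m ∉ Set.range J) :
    minorMap J (fun c => (b c : Fin N → ℂ)) = 0 := by
  obtain ⟨a, ha⟩ := exists_coeff b hm
  rw [minorMap_apply, ← Matrix.exists_mulVec_eq_zero_iff]
  refine ⟨a, ?_, ?_⟩
  · rintro rfl
    have := ha m
    simp at this
  · funext r
    have hne : J r ≠ m := fun e => hJ ⟨r, e⟩
    have := ha (J r)
    rw [Pi.single_eq_of_ne hne] at this
    simp only [Matrix.mulVec, dotProduct, Matrix.of_apply, Pi.zero_apply]
    rw [this]
    exact Finset.sum_congr rfl fun c _ => mul_comm _ _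

theorem minorMap_eq_zero_of_le {l : ℕ} (hW : W ≤ stdSpace N l) {J : Fin k → Fin N} {r : Fin k}
    (hr : l ≤ J r) : minorMap J (fun c => (b c : Fin N → ℂ)) = 0 := by
  rw [minorMap_apply]
  exact Matrix.det_eq_zero_of_row_eq_zero r fun c => hW (b c).2 _ hr

/-- If `e_m ∉ W`, forgetting the coordinate `m` is injective on `W`, so the rows other than `m`
already have full rank. -/
theorem exists_minorMap_ne_zero_of_single_notMem {m : Fin N}
    (hm : (Pi.single m 1 : Fin N → ℂ) ∉ W) :
    ∃ J : Fin k ↪o Fin N, m ∉ Set.range J ∧ minorMap J (fun c => (b c : Fin N → ℂ)) ≠ 0 := by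
  obtain ⟨J, -, hJ, hne⟩ := exists_minorMap_ne_zero (b := fun c => (b c : Fin N → ℂ)) (s := ∅)
    (t := {m}ᶜ) (Set.empty_subset _) (linearIndepOn_empty _ _) (by
      intro a ha
      have hmem := sum_mem_of_basis b a
      have heq : (fun i => ∑ c, a c * (b c : Fin N → ℂ) i) =
          (∑ c, a c * (b c : Fin N → ℂ) m) • (Pi.single m 1 : Fin N → ℂ) := by
        funext i
        by_cases hi : i = m
        · subst hi
          simp
        · simp [ha i hi, hi]
      rw [heq] at hmem
      have hz : ∑ c, a c * (b c : Fin N → ℂ) m = 0 := by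
        by_contra hz
        exact hm ((W.smul_mem_iff hz).mp hmem)
      refine coeff_eq_zero b fun i => ?_
      have := congrFun heq i
      rw [hz, zero_smul] at this
      exact this)
  exact ⟨J, fun h => hJ h rfl, hne⟩

/-- Some row `i ≥ l` is nonzero, and a single nonzero row extends to a basis of rows. -/
theorem exists_minorMap_ne_zero_of_not_le {l : ℕ} (hW : ¬ W ≤ stdSpace N l) :
    ∃ J : Fin k ↪o Fin N, (∃ r, l ≤ J r) ∧ minorMap J (fun c => (b c : Fin N → ℂ)) ≠ 0 := by
  obtain ⟨v, hv, hvl⟩ := SetLike.not_le_iff_exists.mp hW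
  rw [mem_stdSpace] at hvl
  push Not at hvl
  obtain ⟨i, hi, hvi⟩ := hvl
  obtain ⟨J, hJ, -, hne⟩ := exists_minorMap_ne_zero (b := fun c => (b c : Fin N → ℂ)) (s := {i})
    (t := Set.univ) (Set.subset_univ _) (by
      rw [linearIndepOn_singleton_iff]
      intro h0
      obtain ⟨a, ha⟩ := exists_coeff b hv
      apply hvi
      rw [ha]
      exact Finset.sum_eq_zero fun c _ => by rw [congrFun h0 c]; simp)
    (fun a ha => coeff_eq_zero b fun i => ha i trivial)
  obtain ⟨r, hr⟩ := hJ rfl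
  exact ⟨J, ⟨r, hr ▸ hi⟩, hne⟩

end Vanishing

variable {N : ℕ} {ι : Type} {d : ι → ℕ}

theorem isOpen_pluckerCoord_ne_zero [DecidableEq ι] (q : PluckerIndex N d) :
    IsOpen {x : GrProd N d | ∀ p, IsPlucker x p → p q ≠ 0} := by
  refine TopologicalSpace.isOpen_generateFrom_of_mem ⟨X q, Pi.single q.1 1, ?_, ?_⟩
  · exact isWeightedHomogeneous_X _ _ _
  · simp

theorem forall_pluckerCoord_ne_zero {x : GrProd N d} {j : ι}
    {b : Module.Basis (Fin (d j)) ℂ (x.space j)} {J : Fin (d j) ↪o Fin N}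
    (hJ : minorMap J (fun c => (b c : Fin N → ℂ)) ≠ 0) (p : PluckerIndex N d → ℂ)
    (hp : IsPlucker x p) : p ⟨j, J⟩ ≠ 0 := by
  classical
  rw [isPlucker_iff] at hp
  obtain ⟨b', hb'⟩ := hp j
  rw [hb']
  have h := congrArg (fun f => f b')
    (((minorMap J).compLinearMap (x.space j).subtype).eq_smul_basis_det b)
  have h' : minorMap J (fun c => (b' c : Fin N → ℂ)) =
      minorMap J (fun c => (b c : Fin N → ℂ)) * b.det b' := h
  rw [h']
  exact mul_ne_zero hJ (b.isUnit_det b').ne_zero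

/-- Each inclusion is equivalent to the vanishing of certain Plücker coordinates. Where it fails,
one of these coordinates is nonzero and its nonvanishing locus is a neighbourhood avoiding the set.
-/
theorem isClosed_between_stdSpace [DecidableEq ι] (l u : ι → ℕ) :
    IsClosed {x : GrProd N d | ∀ j, stdSpace N (l j) ≤ x.space j ∧ x.space j ≤ stdSpace N (u j)} := by
  rw [← isOpen_compl_iff, isOpen_iff_forall_mem_open]
  intro x hx
  simp only [Set.mem_compl_iff, Set.mem_ofPred_eq, not_forall] at hx
  obtain ⟨j, hj⟩ := hx
  let b := Module.finBasisOfFinrankEq ℂ (x.space j) (x.finrank_space j)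
  rw [not_and_or] at hj
  rcases hj with hj | hj
  · rw [stdSpace_le_iff] at hj
    push Not at hj
    obtain ⟨m, hm, hmx⟩ := hj
    obtain ⟨J, hJ, hne⟩ := exists_minorMap_ne_zero_of_single_notMem b hmx
    refine ⟨_, fun y hy hy' => ?_, isOpen_pluckerCoord_ne_zero ⟨j, J⟩,
      forall_pluckerCoord_ne_zero hne⟩
    obtain ⟨p, hp⟩ := exists_isPlucker y
    refine hy p hp ?_
    obtain ⟨b', hb'⟩ := (isPlucker_iff y p).mp hp j
    rw [hb']
    exact minorMap_eq_zero_of_single_mem b' (stdSpace_le_iff.mp (hy' j).1 m hm) hJ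
  · obtain ⟨J, ⟨r, hr⟩, hne⟩ := exists_minorMap_ne_zero_of_not_le b hj
    refine ⟨_, fun y hy hy' => ?_, isOpen_pluckerCoord_ne_zero ⟨j, J⟩,
      forall_pluckerCoord_ne_zero hne⟩
    obtain ⟨p, hp⟩ := exists_isPlucker y
    refine hy p hp ?_
    obtain ⟨b', hb'⟩ := (isPlucker_iff y p).mp hp j
    rw [hb']
    exact minorMap_eq_zero_of_le b' (hy' j).2 hr

/-! ### Matrices and coordinate subspaces -/

theorem map_stdSpace_le {A : Matrix (Fin N) (Fin N) ℂ} {k l : ℕ}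
    (hA : ∀ i c : Fin N, (c : ℕ) < k → l ≤ i → A i c = 0) :
    (stdSpace N k).map A.toLin' ≤ stdSpace N l := by
  rintro _ ⟨v, hv, rfl⟩ i hi
  rw [Matrix.toLin'_apply, Matrix.mulVec, dotProduct]
  refine Finset.sum_eq_zero fun c _ => ?_
  by_cases hc : (c : ℕ) < k
  · rw [hA i c hc hi, zero_mul]
  · rw [hv c (not_lt.mp hc), mul_zero]

theorem toLin'_injective_of_det_ne_zero {A : Matrix (Fin N) (Fin N) ℂ} (hA : A.det ≠ 0) :
    Function.Injective A.toLin' := by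
  exact Matrix.mulVec_injective_iff_isUnit.mpr
    ((Matrix.isUnit_iff_isUnit_det A).mpr (isUnit_iff_ne_zero.mpr hA))

theorem finrank_map_toLin' {A : Matrix (Fin N) (Fin N) ℂ} (hA : A.det ≠ 0)
    (W : Submodule ℂ (Fin N → ℂ)) : Module.finrank ℂ (W.map A.toLin') = Module.finrank ℂ W :=
  (Submodule.equivMapOfInjective _ (toLin'_injective_of_det_ne_zero hA) W).finrank_eq.symm

theorem map_stdSpace_eq {A : Matrix (Fin N) (Fin N) ℂ} (hdet : A.det ≠ 0) {k : ℕ}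
    (hA : ∀ i c : Fin N, (c : ℕ) < k → k ≤ i → A i c = 0) :
    (stdSpace N k).map A.toLin' = stdSpace N k :=
  Submodule.eq_of_le_of_finrank_eq (map_stdSpace_le hA) (finrank_map_toLin' hdet _)

theorem coordSpace_eq_map {n : ℕ} (ℓ : Fin n → ℕ) (w : Equiv.Perm (Fin N)) (j : Fin n) :
    coordSpace ℓ w j =
      (stdSpace N (ℓ j)).map (LinearEquiv.funCongrLeft ℂ ℂ w.symm).toLinearMap := by
  have hsingle : ∀ a : Fin N, LinearEquiv.funCongrLeft ℂ ℂ w.symm (Pi.single a 1) =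
      (Pi.single (w a) 1 : Fin N → ℂ) := by
    intro a
    funext i
    simp only [LinearEquiv.funCongrLeft_apply, LinearMap.funLeft_apply, Pi.single_apply,
      Equiv.symm_apply_eq]
  apply le_antisymm
  · refine Submodule.span_le.mpr ?_
    rintro _ ⟨a, ha, rfl⟩
    exact ⟨Pi.single a 1, single_mem_stdSpace ha, hsingle a⟩
  · rw [Submodule.map_le_iff_le_comap, stdSpace_le_iff]
    intro a ha
    rw [Submodule.mem_comap, LinearEquiv.coe_coe, hsingle]
    exact Submodule.subset_span ⟨a, ha, rfl⟩

theorem finrank_coordSpace {n : ℕ} {ℓ : Fin n → ℕ} (w : Equiv.Perm (Fin N)) {j : Fin n}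
    (hj : ℓ j ≤ N) : Module.finrank ℂ (coordSpace ℓ w j) = ℓ j := by
  rw [coordSpace_eq_map, LinearEquiv.finrank_map_eq, finrank_stdSpace hj]

/-- The bounds are closed conditions, and upper triangular matrices preserve every `stdSpace`, so it
suffices to check them on the coordinate flag of `w`. -/
theorem schubertVariety_subset {n : ℕ} {ℓ l u : Fin n → ℕ} {w : Equiv.Perm (Fin N)}
    (hl : ∀ j, ∀ m : Fin N, (m : ℕ) < l j → (w.symm m : ℕ) < ℓ j)
    (hu : ∀ j, ∀ a : Fin N, (a : ℕ) < ℓ j → (w a : ℕ) < u j) :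
    schubertVariety ℓ w ⊆ {x | Monotone x.space ∧
      ∀ j, stdSpace N (l j) ≤ x.space j ∧ x.space j ≤ stdSpace N (u j)} := by
  rintro x ⟨hx, hmono⟩
  refine ⟨hmono, closure_minimal ?_ (isClosed_between_stdSpace l u) hx⟩
  rintro y ⟨A, hA, hy⟩ j
  have hA' : ∀ (k : ℕ) (i c : Fin N), (c : ℕ) < k → k ≤ i → A.1 i c = 0 :=
    fun k i c hc hi => hA (show c < i from Fin.lt_def.mpr (by omega))
  rw [hy]
  constructor
  · rw [← map_stdSpace_eq (A := A.1) (by rw [A.2]; exact one_ne_zero) (hA' (l j))]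
    refine Submodule.map_mono (stdSpace_le_iff.mpr fun m hm => ?_)
    refine Submodule.subset_span ⟨w.symm m, hl j m hm, ?_⟩
    simp
  · refine le_trans (Submodule.map_mono ?_) (map_stdSpace_le (hA' (u j)))
    refine Submodule.span_le.mpr ?_
    rintro _ ⟨a, ha, rfl⟩
    exact single_mem_stdSpace (hu j a ha)

end

section

/-! ### The permutation of a projection sequence -/

/-- The product `g (m - 1) * ⋯ * g 1 * g 0`. -/
def prodDown {M : Type*} [Monoid M] (g : ℕ → M) : ℕ → M
  | 0 => 1
  | m + 1 => g m * prodDown g m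

theorem prod_reverse_ofFn {M : Type*} [Monoid M] (g : ℕ → M) (n : ℕ) :
    (List.ofFn fun j : Fin n => g j).reverse.prod = prodDown g n := by
  induction n with
  | zero => rfl
  | succ n ih =>
    rw [List.ofFn_succ', List.concat_eq_append, List.reverse_append, prodDown, ← ih]
    simp

theorem prod_simpleReflection_apply {m h r : ℕ} (hr : h + r ≤ m) (y : Fin (m + 1)) :
    ((List.ofFn fun t : Fin r => simpleReflection (⟨h + t, by omega⟩ : Fin m)).prod y : ℕ) =
      if (y : ℕ) < h then (y : ℕ) else if (y : ℕ) < h + r then y + 1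
        else if (y : ℕ) = h + r then h else y := by
  induction r generalizing y with
  | zero =>
    simp only [List.ofFn_zero, List.prod_nil, Equiv.Perm.one_apply]
    split_ifs <;> omega
  | succ r ih =>
    rw [List.ofFn_succ', List.concat_eq_append, List.prod_append, List.prod_singleton,
      Equiv.Perm.mul_apply]
    simp only [Fin.val_castSucc, Fin.val_last]
    rw [ih (by omega)]
    have hs : (simpleReflection (⟨h + r, by omega⟩ : Fin m) y : ℕ) =
        if (y : ℕ) = h + r then h + r + 1 else if (y : ℕ) = h + r + 1 then h + r else y := by
      simp only [simpleReflection, Equiv.swap_apply_def, Fin.ext_iff, Fin.val_castSucc,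
        Fin.val_succ]
      split_ifs <;> simp
    rw [hs]
    split_ifs <;> omega

variable {n : ℕ}

/-- The numbers `h_s`, for all natural numbers `s`. -/
def hNat (I : Finset (Fin (n - 1))) (s : ℕ) : ℕ := (I.filter fun i : Fin (n - 1) => (i : ℕ) < s).card

theorem hNat_le_card (I : Finset (Fin (n - 1))) (s : ℕ) : hNat I s ≤ I.card :=
  Finset.card_filter_le _ _

theorem hNat_mono (I : Finset (Fin (n - 1))) : Monotone (hNat I) := by
  intro s t hst
  apply Finset.card_le_card
  intro i hi
  rw [Finset.mem_filter] at hi ⊢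
  exact ⟨hi.1, hi.2.trans_le hst⟩

theorem hNat_succ_le (I : Finset (Fin (n - 1))) (s : ℕ) : hNat I (s + 1) ≤ hNat I s + 1 := by
  by_cases hs : s < n - 1
  · refine (Finset.card_le_card (t := insert ⟨s, hs⟩ (I.filter fun i : Fin (n - 1) => (i : ℕ) < s)) ?_).trans
      (Finset.card_insert_le _ _)
    intro i hi
    rw [Finset.mem_insert, Finset.mem_filter, Fin.ext_iff]
    rw [Finset.mem_filter] at hi
    by_cases h : (i : ℕ) = s
    · exact Or.inl h
    · exact Or.inr ⟨hi.1, by omega⟩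
  · refine le_trans (Finset.card_le_card ?_) (Nat.le_succ _)
    intro i hi
    rw [Finset.mem_filter] at hi ⊢
    exact ⟨hi.1, by omega⟩

theorem hNat_le_add {H : ℕ → ℕ} (hH : ∀ s, H (s + 1) ≤ H s + 1) {s t : ℕ} (hst : s ≤ t) :
    H t ≤ H s + (t - s) := by
  induction t, hst using Nat.le_induction with
  | base => omega
  | succ t ht ih => have := hH t; omega

/-- The factors of the permutation of a projection sequence, extended to all natural numbers. -/
def wFactorNat (I : Finset (Fin (n - 1))) (s : ℕ) : Equiv.Perm (Fin (n + I.card + 1)) :=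
  if hs : s < n then wFactor I ⟨s, hs⟩ else 1

theorem wSeq_eq_prodDown (I : Finset (Fin (n - 1))) : wSeq I = prodDown (wFactorNat I) n := by
  rw [← prod_reverse_ofFn, wSeq]
  congr 3
  funext j
  simp [wFactorNat]

theorem wFactorNat_apply (I : Finset (Fin (n - 1))) {s : ℕ} (hs : s < n)
    (y : Fin (n + I.card + 1)) :
    (wFactorNat I s y : ℕ) =
      if (y : ℕ) < hNat I s then (y : ℕ) else if (y : ℕ) < hNat I s + (s + 1) then y + 1
        else if (y : ℕ) = hNat I s + (s + 1) then hNat I s else y := by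
  rw [wFactorNat, dif_pos hs]
  have := hNat_le_card I s
  exact prod_simpleReflection_apply (h := hNat I s) (r := s + 1) (by omega) y

/-- This tracks the image of `{a < ℓ_j}` under the partial products: once the factors below `j` are
used up, each further factor fixes the part below `h_j` and pushes the remaining block of length `j
+ 1` up by one. -/
theorem prodDown_wFactorNat_lt_iff (I : Finset (Fin (n - 1))) {j m : ℕ} (hj : j ≤ m) (hm : m ≤ n)
    (a : Fin (n + I.card + 1)) :
    ((prodDown (wFactorNat I) m a : ℕ) < hNat I j ∨
      (hNat I j + (m - j) ≤ (prodDown (wFactorNat I) m a : ℕ) ∧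
        (prodDown (wFactorNat I) m a : ℕ) < hNat I j + (m + 1))) ↔
      (a : ℕ) < hNat I j + (j + 1) := by
  induction m, hj using Nat.le_induction with
  | base =>
    -- A factor `s < j` is a cycle on `h_s, …, h_s + s + 1`, all below `ℓ_j`, so it preserves `{a <
    -- ℓ_j}`.
    have key : ∀ m ≤ j, ((prodDown (wFactorNat I) m a : ℕ) < hNat I j + (j + 1) ↔
        (a : ℕ) < hNat I j + (j + 1)) := by
      intro m hmj
      induction m with
      | zero => rfl
      | succ m ih =>
        rw [← ih (by omega), prodDown, Equiv.Perm.mul_apply, wFactorNat_apply I (by omega)]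
        have := hNat_mono I (show m ≤ j by omega)
        split_ifs <;> omega
    rw [← key j le_rfl]
    omega
  | succ m hjm ih =>
    -- Since `h_m ≤ h_j + (m - j)`, the block lies in the range where the factor `m` adds one; since
    -- `h_j ≤ h_m`, the lower part is fixed.
    rw [← ih (by omega), prodDown, Equiv.Perm.mul_apply, wFactorNat_apply I (by omega)]
    have := hNat_mono I hjm
    have := hNat_le_add (hNat_succ_le I) hjm
    split_ifs <;> omega

theorem wSeq_lt_iff (I : Finset (Fin (n - 1))) (j : Fin n) (a : Fin (n + I.card + 1)) :
    (a : ℕ) < ell I j ↔ ((wSeq I a : ℕ) < h I j ∨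
      (h I j + (n - j) ≤ (wSeq I a : ℕ) ∧ (wSeq I a : ℕ) < h I j + (n + 1))) := by
  rw [wSeq_eq_prodDown]
  exact (prodDown_wFactorNat_lt_iff I j.2.le le_rfl a).symm

theorem schubertVariety_subset_windowFlags (I : Finset (Fin (n - 1))) :
    schubertVariety (ell I) (wSeq I) ⊆ windowFlags I := by
  refine schubertVariety_subset (fun j m hm => ?_) fun j a ha => ?_
  · rw [wSeq_lt_iff, Equiv.apply_symm_apply]
    exact Or.inl hm
  · rw [wSeq_lt_iff] at ha
    omega

end

section

/-! ### Flags as products of matrices of Hessenberg type -/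

theorem exists_submodule_between {N k : ℕ} {L U : Submodule ℂ (Fin N → ℂ)} (hLU : L ≤ U)
    (hL : Module.finrank ℂ L ≤ k) (hU : k ≤ Module.finrank ℂ U) :
    ∃ D, L ≤ D ∧ D ≤ U ∧ Module.finrank ℂ D = k := by
  induction k, hL using Nat.le_induction with
  | base => exact ⟨L, le_rfl, hLU, rfl⟩
  | succ k hk ih =>
    obtain ⟨D, hLD, hDU, hD⟩ := ih (by omega)
    have hne : ¬ U ≤ D := fun h => by
      have := Submodule.finrank_mono h
      omega
    obtain ⟨v, hvU, hvD⟩ := SetLike.not_le_iff_exists.mp hne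
    refine ⟨D ⊔ Submodule.span ℂ {v}, hLD.trans le_sup_left, sup_le hDU ?_, ?_⟩
    · rwa [Submodule.span_singleton_le_iff_mem]
    · rw [Submodule.finrank_sup_span_singleton hvD, hD]

section Flag

variable {N m : ℕ} {H : ℕ → ℕ} {W : ℕ → Submodule ℂ (Fin N → ℂ)}

/-- The conditions on the `k`-dimensional member of a complete flag adapted to `W`. -/
structure IsAdapted (H : ℕ → ℕ) (W : ℕ → Submodule ℂ (Fin N → ℂ)) (m k : ℕ)
    (A : Submodule ℂ (Fin N → ℂ)) : Prop where
  finrank_eq : Module.finrank ℂ A = k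
  std_le : stdSpace N (H m) ≤ A
  le_std : A ≤ stdSpace N (k + 1)
  le : ∀ s < m, H s + (m + 1) ≤ k → W s ≤ A

/-- Any `k`-dimensional space between `L` and `A ∩ ℂ^{k+1}` works, where `L` is `ℂ^{H m}` plus the
largest `W s` that has to be contained at level `k`. The proof is the dimension count making room
for it. -/
theorem IsAdapted.exists_pred (hmono : Monotone H) (hsucc : ∀ s, H (s + 1) ≤ H s + 1)
    (hW : ∀ s t, s ≤ t → t ≤ m → W s ≤ W t) (hl : ∀ s ≤ m, stdSpace N (H s) ≤ W s)
    (hu : ∀ s ≤ m, W s ≤ stdSpace N (H s + (m + 2)))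
    (hrank : ∀ s ≤ m, Module.finrank ℂ (W s) = H s + (s + 1)) {k : ℕ} (hk : H m ≤ k)
    (hkN : k + 2 ≤ N) {A : Submodule ℂ (Fin N → ℂ)} (hA : IsAdapted H W m (k + 1) A) :
    ∃ B ≤ A, IsAdapted H W m k B := by
  -- Both spaces have dimension `k + 1` and lie in `ℂ^{k+2}`.
  have hdim : k ≤ Module.finrank ℂ (A ⊓ stdSpace N (k + 1) : Submodule ℂ (Fin N → ℂ)) := by
    have h₁ := Submodule.finrank_sup_add_finrank_inf_eq A (stdSpace N (k + 1))
    have h₂ : Module.finrank ℂ (A ⊔ stdSpace N (k + 1) : Submodule ℂ (Fin N → ℂ)) ≤ k + 2 := by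
      rw [← finrank_stdSpace hkN]
      exact Submodule.finrank_mono (sup_le hA.le_std (stdSpace_mono N (by omega)))
    rw [hA.finrank_eq, finrank_stdSpace (by omega)] at h₁
    omega
  obtain ⟨L, hLk, hLA, hLstd, hLW⟩ : ∃ L : Submodule ℂ (Fin N → ℂ), Module.finrank ℂ L ≤ k ∧
      L ≤ A ⊓ stdSpace N (k + 1) ∧ stdSpace N (H m) ≤ L ∧
      ∀ s < m, H s + (m + 1) ≤ k → W s ≤ L := by
    by_cases hex : ∃ s, s < m ∧ H s + (m + 1) ≤ k
    · obtain ⟨s, hs, hmax⟩ := Finset.exists_max_image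
        ((Finset.range m).filter fun s => H s + (m + 1) ≤ k) id (by
          obtain ⟨s, hs⟩ := hex
          exact ⟨s, by simpa using hs⟩)
      simp only [Finset.mem_filter, Finset.mem_range, id, and_imp] at hs hmax
      obtain ⟨hsm, hsk⟩ := hs
      -- The two summands share `ℂ^{H s}`, so the dimension is at most `H m + s + 1 ≤ H s + m + 1 ≤
      -- k`, as `H` grows by at most one per step.
      refine ⟨stdSpace N (H m) ⊔ W s, ?_, ?_, le_sup_left, ?_⟩
      · have h₁ := Submodule.finrank_sup_add_finrank_inf_eq (stdSpace N (H m)) (W s)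
        have h₂ : H s ≤ Module.finrank ℂ (stdSpace N (H m) ⊓ W s : Submodule ℂ (Fin N → ℂ)) := by
          have := hmono hsm.le
          rw [← finrank_stdSpace (N := N) (k := H s) (by omega)]
          exact Submodule.finrank_mono (le_inf (stdSpace_mono N (by omega)) (hl s hsm.le))
        rw [finrank_stdSpace (by omega), hrank s hsm.le] at h₁
        have := hNat_le_add hsucc hsm.le
        omega
      · refine sup_le (le_inf hA.std_le (stdSpace_mono N (by omega)))
          (le_inf (hA.le s hsm (by omega)) ((hu s hsm.le).trans (stdSpace_mono N (by omega))))
      · exact fun t ht htk => (hW t s (hmax t ht htk) hsm.le).trans le_sup_right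
    · refine ⟨stdSpace N (H m), ?_, le_inf hA.std_le (stdSpace_mono N (by omega)), le_rfl,
        fun s hs hsk => absurd ⟨s, hs, hsk⟩ hex⟩
      rw [finrank_stdSpace (by omega)]
      exact hk
  obtain ⟨B, hLB, hBU, hB⟩ := exists_submodule_between hLA hLk hdim
  exact ⟨B, hBU.trans inf_le_left, hB, hLstd.trans hLB, hBU.trans inf_le_right,
    fun s hs hsk => (hLW s hs hsk).trans hLB⟩

/-- The complete flag is built downwards from `W m`; `i` counts the levels already constructed below
it. -/
theorem exists_adapted_chain (hmono : Monotone H) (hsucc : ∀ s, H (s + 1) ≤ H s + 1)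
    (hW : ∀ s t, s ≤ t → t ≤ m → W s ≤ W t) (hl : ∀ s ≤ m, stdSpace N (H s) ≤ W s)
    (hu : ∀ s ≤ m, W s ≤ stdSpace N (H s + (m + 2)))
    (hrank : ∀ s ≤ m, Module.finrank ℂ (W s) = H s + (s + 1)) (hN : H m + (m + 2) ≤ N) :
    ∀ i ≤ m + 1, ∃ D : ℕ → Submodule ℂ (Fin N → ℂ), D (H m + (m + 1)) = W m ∧
      (∀ k, H m + (m + 1) - i ≤ k → k ≤ H m + (m + 1) → IsAdapted H W m k (D k)) ∧
      ∀ k, H m + (m + 1) - i ≤ k → k < H m + (m + 1) → D k ≤ D (k + 1) := by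
  intro i
  induction i with
  | zero =>
    intro _
    refine ⟨fun _ => W m, rfl, fun k hk hk' => ?_, fun k hk hk' => le_rfl⟩
    obtain rfl : k = H m + (m + 1) := by omega
    exact ⟨hrank m le_rfl, hl m le_rfl, hu m le_rfl, fun s hs _ => hW s m hs.le le_rfl⟩
  | succ i ih =>
    intro hi
    obtain ⟨D, hD, hadapt, hle⟩ := ih (by omega)
    obtain ⟨k₀, hk₀⟩ : ∃ k₀, H m + (m + 1) - i = k₀ + 1 := ⟨H m + (m + 1) - i - 1, by omega⟩
    obtain ⟨B, hBA, hB⟩ := (hadapt (k₀ + 1) (by omega) (by omega)).exists_pred hmono hsucc hW hl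
      hu hrank (by omega) (by omega)
    refine ⟨Function.update D k₀ B, ?_, fun k hk hk' => ?_, fun k hk hk' => ?_⟩
    · rw [Function.update_of_ne (by omega), hD]
    · by_cases h : k = k₀
      · subst h
        rwa [Function.update_self]
      · rw [Function.update_of_ne h]
        exact hadapt k (by omega) hk'
    · rw [Function.update_of_ne (show k + 1 ≠ k₀ by omega)]
      by_cases h : k = k₀
      · subst h
        rwa [Function.update_self]
      · rw [Function.update_of_ne h]
        exact hle k (by omega) hk'

/-- Upper triangular matrices with additional subdiagonal entries in the columns
`h, …, h + r - 1`. -/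
def IsHessenberg (h r : ℕ) (A : Matrix (Fin N) (Fin N) ℂ) : Prop :=
  ∀ i c : Fin N, (c : ℕ) < i → ¬ ((i : ℕ) = c + 1 ∧ h ≤ c ∧ (c : ℕ) < h + r) → A i c = 0

theorem IsHessenberg.map_stdSpace_le_succ {h r : ℕ} {A : Matrix (Fin N) (Fin N) ℂ}
    (hA : IsHessenberg h r A) (k : ℕ) :
    (stdSpace N k).map A.toLin' ≤ stdSpace N (k + 1) :=
  map_stdSpace_le fun i c hc hi => hA i c (by omega) (by omega)

theorem IsHessenberg.map_stdSpace_eq {h r : ℕ} {A : Matrix (Fin N) (Fin N) ℂ}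
    (hA : IsHessenberg h r A) (hdet : A.det ≠ 0) {k : ℕ} (hk : k ≤ h ∨ h + r < k) :
    (stdSpace N k).map A.toLin' = stdSpace N k :=
  LinDegFlag.map_stdSpace_eq hdet fun i c hc hi => hA i c (by omega) (by omega)

/-- A complete flag `D` with `D_k ⊆ ℂ^{k+1}` is the image of the standard flag under a matrix of
Hessenberg type. -/
theorem exists_matrix_of_flag {h r : ℕ} {D : ℕ → Submodule ℂ (Fin N → ℂ)}
    (hrank : ∀ k ≤ N, Module.finrank ℂ (D k) = k) (hD : ∀ k < N, D k ≤ D (k + 1))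
    (hstd : ∀ k, D k ≤ stdSpace N (k + 1)) (hfix : ∀ k, k ≤ h ∨ h + r < k → D k ≤ stdSpace N k) :
    ∃ A : Matrix (Fin N) (Fin N) ℂ, IsHessenberg h r A ∧ A.det ≠ 0 ∧
      ∀ k ≤ N, (stdSpace N k).map A.toLin' = D k := by
  -- The columns of the matrix are vectors of `D (c + 1)` outside `D c`; the bounds on `D` are then
  -- bounds on the lowest nonzero entry of each column.
  have hex : ∀ c : Fin N, ∃ v, v ∈ D (c + 1) ∧ v ∉ D c := fun c => by
    refine SetLike.not_le_iff_exists.mp fun hle => ?_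
    have := Submodule.finrank_mono hle
    rw [hrank _ c.2, hrank _ c.2.le] at this
    omega
  choose v hv hv' using hex
  set A : Matrix (Fin N) (Fin N) ℂ := Matrix.of fun i c => v c i with hA
  have hcol : ∀ c, A.toLin' (Pi.single c 1) = v c := fun c => by
    rw [Matrix.toLin'_apply, Matrix.mulVec_single_one]
    rfl
  have hle : ∀ k ≤ N, D k ≤ (stdSpace N k).map A.toLin' := by
    intro k
    induction k with
    | zero =>
      intro _
      rw [Submodule.finrank_eq_zero.mp (hrank 0 (Nat.zero_le _))]
      exact bot_le
    | succ k ih =>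
      intro hk
      have hsup : D k ⊔ Submodule.span ℂ {v ⟨k, hk⟩} = D (k + 1) := by
        refine Submodule.eq_of_le_of_finrank_le (sup_le (hD k hk) ?_) ?_
        · rw [Submodule.span_singleton_le_iff_mem]
          exact hv ⟨k, hk⟩
        · rw [Submodule.finrank_sup_span_singleton (hv' ⟨k, hk⟩), hrank _ hk, hrank k (by omega)]
      rw [← hsup]
      refine sup_le ((ih (by omega)).trans (Submodule.map_mono (stdSpace_mono N (by omega)))) ?_
      rw [Submodule.span_singleton_le_iff_mem]
      exact ⟨Pi.single ⟨k, hk⟩ 1, single_mem_stdSpace (Nat.lt_succ_self k), hcol _⟩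
  have hdet : A.det ≠ 0 := by
    have hsurj : Function.Surjective A.toLin' := by
      rw [← LinearMap.range_eq_top, eq_top_iff, ← Submodule.map_top, ← stdSpace_eq_top N le_rfl]
      refine le_trans ?_ (hle N le_rfl)
      rw [Submodule.eq_top_of_finrank_eq ((hrank N le_rfl).trans (Module.finrank_fin_fun ℂ).symm)]
      exact le_top
    have : Function.Surjective A.mulVec := hsurj
    rw [Matrix.mulVec_surjective_iff_isUnit, Matrix.isUnit_iff_isUnit_det] at this
    exact this.ne_zero
  refine ⟨A, fun i c hci hn => ?_, hdet, fun k hk => ?_⟩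
  · by_cases h₁ : (i : ℕ) = c + 1
    · exact hfix (c + 1) (by omega) (hv c) i (by omega)
    · exact hstd (c + 1) (hv c) i (by omega)
  · refine (Submodule.eq_of_le_of_finrank_eq (hle k hk) ?_).symm
    rw [finrank_map_toLin' hdet, finrank_stdSpace hk, hrank k hk]

/-- This splits off the last factor. The final inclusion says that after applying `A⁻¹` the
remaining `W s` satisfy the upper bound with `m` lowered by one, so that induction can continue. -/
theorem exists_hessenberg (hmono : Monotone H) (hsucc : ∀ s, H (s + 1) ≤ H s + 1)
    (hW : ∀ s t, s ≤ t → t ≤ m → W s ≤ W t) (hl : ∀ s ≤ m, stdSpace N (H s) ≤ W s)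
    (hu : ∀ s ≤ m, W s ≤ stdSpace N (H s + (m + 2)))
    (hrank : ∀ s ≤ m, Module.finrank ℂ (W s) = H s + (s + 1)) (hN : H m + (m + 2) ≤ N) :
    ∃ A : Matrix (Fin N) (Fin N) ℂ, IsHessenberg (H m) (m + 1) A ∧ A.det ≠ 0 ∧
      (stdSpace N (H m + (m + 1))).map A.toLin' = W m ∧
      ∀ s < m, W s ≤ (stdSpace N (H s + (m + 1))).map A.toLin' := by
  obtain ⟨D, hDm, hadapt, hle⟩ := exists_adapted_chain hmono hsucc hW hl hu hrank hN (m + 1) le_rfl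
  rw [Nat.add_sub_cancel] at hadapt hle
  -- The adapted chain starts at `ℂ^{H m}` and is completed by the standard flag on both sides.
  -- Hence only the columns `H m, …, H m + m` need subdiagonal entries.
  set D' : ℕ → Submodule ℂ (Fin N → ℂ) := fun k =>
    if H m ≤ k ∧ k ≤ H m + (m + 1) then D k else stdSpace N k with hD'
  have hin : ∀ k, H m ≤ k → k ≤ H m + (m + 1) → D' k = D k := fun k h₁ h₂ => if_pos ⟨h₁, h₂⟩
  have hout : ∀ k, ¬ (H m ≤ k ∧ k ≤ H m + (m + 1)) → D' k = stdSpace N k := fun k h => if_neg h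
  have hbase : D (H m) = stdSpace N (H m) := by
    have h := hadapt (H m) le_rfl (by omega)
    exact (Submodule.eq_of_le_of_finrank_eq h.std_le
      ((finrank_stdSpace (by omega)).trans h.finrank_eq.symm)).symm
  obtain ⟨A, hA, hdet, hmap⟩ := exists_matrix_of_flag (h := H m) (r := m + 1) (D := D')
    (fun k hk => by
      by_cases h : H m ≤ k ∧ k ≤ H m + (m + 1)
      · rw [hin k h.1 h.2, (hadapt k h.1 h.2).finrank_eq]
      · rw [hout k h, finrank_stdSpace hk])
    (fun k hk => by
      rcases lt_trichotomy (k + 1) (H m) with h | h | h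
      · rw [hout k (by omega), hout (k + 1) (by omega)]
        exact stdSpace_mono N (by omega)
      · rw [hout k (by omega), hin (k + 1) (by omega) (by omega), h, hbase]
        exact stdSpace_mono N (by omega)
      · rcases lt_trichotomy k (H m + (m + 1)) with h' | h' | h'
        · rw [hin k (by omega) (by omega), hin (k + 1) (by omega) (by omega)]
          exact hle k (by omega) h'
        · rw [hin k (by omega) (by omega), hout (k + 1) (by omega)]
          exact (hadapt k (by omega) (by omega)).le_std
        · rw [hout k (by omega), hout (k + 1) (by omega)]
          exact stdSpace_mono N (by omega))
    (fun k => by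
      by_cases h : H m ≤ k ∧ k ≤ H m + (m + 1)
      · rw [hin k h.1 h.2]
        exact (hadapt k h.1 h.2).le_std
      · rw [hout k h]
        exact stdSpace_mono N (by omega))
    (fun k hk => by
      by_cases h : k = H m
      · subst h
        rw [hin _ le_rfl (by omega), hbase]
      · rw [hout k (by omega)])
  refine ⟨A, hA, hdet, ?_, fun s hs => ?_⟩
  · rw [hmap _ (by omega), hin _ (by omega) le_rfl, hDm]
  · have h₁ := hNat_le_add hsucc hs.le
    have h₂ := hmono hs.le
    rw [hmap _ (by omega), hin _ (by omega) (by omega)]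
    exact (hadapt _ (by omega) (by omega)).le s hs le_rfl

end Flag

/-! ### Products of Hessenberg matrices acting on the standard flag -/

section Product

variable {N n : ℕ} {H : ℕ → ℕ} {g : ℕ → Matrix (Fin N) (Fin N) ℂ}

theorem toLin'_prodDown_succ (g : ℕ → Matrix (Fin N) (Fin N) ℂ) (m : ℕ)
    (S : Submodule ℂ (Fin N → ℂ)) :
    S.map (prodDown g (m + 1)).toLin' = (S.map (prodDown g m).toLin').map (g m).toLin' := by
  rw [prodDown, Matrix.toLin'_mul, Submodule.map_comp]

theorem det_prodDown_ne_zero {m : ℕ} (hdet : ∀ s < m, (g s).det ≠ 0) :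
    (prodDown g m).det ≠ 0 := by
  induction m with
  | zero => simp [prodDown]
  | succ m ih =>
    rw [prodDown, Matrix.det_mul]
    exact mul_ne_zero (hdet m (Nat.lt_succ_self m)) (ih fun s hs => hdet s (by omega))

theorem map_prodDown_stdSpace_eq {m k : ℕ}
    (hg : ∀ s < m, IsHessenberg (H s) (s + 1) (g s) ∧ (g s).det ≠ 0)
    (hk : ∀ s < m, H s + (s + 1) < k) :
    (stdSpace N k).map (prodDown g m).toLin' = stdSpace N k := by
  induction m with
  | zero => simp [prodDown]
  | succ m ih =>
    rw [toLin'_prodDown_succ, ih (fun s hs => hg s (by omega)) (fun s hs => hk s (by omega))]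
    have hm := hg m (Nat.lt_succ_self m)
    exact hm.1.map_stdSpace_eq hm.2 (Or.inr (hk m (Nat.lt_succ_self m)))

theorem prodDown_congr {M : Type*} [Monoid M] {g g' : ℕ → M} {m : ℕ} (h : ∀ s < m, g s = g' s) :
    prodDown g m = prodDown g' m := by
  induction m with
  | zero => rfl
  | succ m ih => rw [prodDown, prodDown, h m (Nat.lt_succ_self m), ih fun s hs => h s (by omega)]

/-- Factors before `j` fix `ℂ^{H j + j + 1}`. Each of the `n - j` later ones fixes `ℂ^{H j}` and
raises the upper bound by at most one. -/
theorem prodDown_map_between (hmono : Monotone H)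
    (hg : ∀ s < n, IsHessenberg (H s) (s + 1) (g s) ∧ (g s).det ≠ 0) {j : ℕ} (hj : j < n) :
    stdSpace N (H j) ≤ (stdSpace N (H j + (j + 1))).map (prodDown g n).toLin' ∧
      (stdSpace N (H j + (j + 1))).map (prodDown g n).toLin' ≤ stdSpace N (H j + (n + 1)) := by
  have key : ∀ m, j ≤ m → m ≤ n →
      stdSpace N (H j) ≤ (stdSpace N (H j + (j + 1))).map (prodDown g m).toLin' ∧
      (stdSpace N (H j + (j + 1))).map (prodDown g m).toLin' ≤ stdSpace N (H j + (m + 1)) := by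
    intro m hm
    induction m, hm using Nat.le_induction with
    | base =>
      intro _
      rw [map_prodDown_stdSpace_eq (fun s hs => hg s (by omega))
        (fun s hs => by have := hmono hs.le; omega)]
      exact ⟨stdSpace_mono N (by omega), le_rfl⟩
    | succ m hm ih =>
      intro hmn
      obtain ⟨h₁, h₂⟩ := ih (by omega)
      have hgm := hg m (by omega)
      rw [toLin'_prodDown_succ]
      constructor
      · rw [← hgm.1.map_stdSpace_eq hgm.2 (Or.inl (hmono hm))]
        exact Submodule.map_mono h₁
      · exact (Submodule.map_mono h₂).trans (hgm.1.map_stdSpace_le_succ _)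
  exact key n hj.le le_rfl

/-- Induction on the number of members: `exists_hessenberg` supplies the last factor `A`, and the
earlier members are pulled back along `A`. The member `W m` needs no correction, because the earlier
factors fix `ℂ^{H m + m + 1}`. -/
theorem exists_prodDown_eq (hmono : Monotone H) (hsucc : ∀ s, H (s + 1) ≤ H s + 1) (m : ℕ)
    (W : ℕ → Submodule ℂ (Fin N → ℂ)) (hW : ∀ s t, s ≤ t → t < m → W s ≤ W t)
    (hl : ∀ s < m, stdSpace N (H s) ≤ W s) (hu : ∀ s < m, W s ≤ stdSpace N (H s + (m + 1)))
    (hrank : ∀ s < m, Module.finrank ℂ (W s) = H s + (s + 1))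
    (hN : ∀ s < m, H s + (m + 1) ≤ N) :
    ∃ g : ℕ → Matrix (Fin N) (Fin N) ℂ,
      (∀ s < m, IsHessenberg (H s) (s + 1) (g s) ∧ (g s).det ≠ 0) ∧
      ∀ s < m, W s = (stdSpace N (H s + (s + 1))).map (prodDown g m).toLin' := by
  induction m generalizing W with
  | zero => exact ⟨fun _ => 1, by simp, by simp⟩
  | succ m ih =>
    obtain ⟨A, hA, hdet, hAm, hAs⟩ := exists_hessenberg (m := m) (W := W) hmono hsucc
      (fun s t hst ht => hW s t hst (by omega)) (fun s hs => hl s (by omega))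
      (fun s hs => hu s (by omega)) (fun s hs => hrank s (by omega)) (hN m (by omega))
    have hinj := toLin'_injective_of_det_ne_zero hdet
    have hcomap : ∀ s ≤ m, ((W s).comap A.toLin').map A.toLin' = W s := fun s _ =>
      Submodule.map_comap_eq_of_surjective (LinearMap.injective_iff_surjective.mp hinj) _
    obtain ⟨g, hg, hgW⟩ := ih (fun s => (W s).comap A.toLin')
      (fun s t hst ht => Submodule.comap_mono (hW s t hst (by omega)))
      (fun s hs => by
        rw [← Submodule.map_le_iff_le_comap, hA.map_stdSpace_eq hdet (Or.inl (hmono hs.le))]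
        exact hl s (by omega))
      (fun s hs => by
        rw [← Submodule.map_le_map_iff_of_injective hinj, hcomap s hs.le]
        exact hAs s hs)
      (fun s hs => by
        rw [← finrank_map_toLin' hdet, hcomap s hs.le]
        exact hrank s (by omega))
      (fun s hs => by have := hN s (by omega); omega)
    refine ⟨fun s => if s < m then g s else A, fun s hs => ?_, fun s hs => ?_⟩
    · by_cases h : s < m
      · simpa only [h, if_true] using hg s h
      · obtain rfl : s = m := by omega
        simpa using ⟨hA, hdet⟩
    · rw [toLin'_prodDown_succ, prodDown_congr (g' := g) (fun t ht => if_pos ht),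
        if_neg (lt_irrefl m)]
      by_cases h : s < m
      · rw [← hgW s h, hcomap s h.le]
      · obtain rfl : s = m := by omega
        rw [map_prodDown_stdSpace_eq hg (fun t ht => by have := hmono ht.le; omega), hAm]

end Product

end

section

/-! ### The Schubert variety of a projection sequence -/

variable {n : ℕ}

theorem ell_le (I : Finset (Fin (n - 1))) (j : Fin n) : ell I j ≤ n + I.card + 1 := by
  have := h_le I j
  unfold ell
  omega

theorem ell_mono (I : Finset (Fin (n - 1))) : Monotone (ell I) := fun i j hij => by
  have h₁ : h I i ≤ h I j := hNat_mono I (Fin.le_iff_val_le_val.mp hij)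
  have h₂ : (i : ℕ) ≤ j := Fin.le_iff_val_le_val.mp hij
  unfold ell
  omega

/-- These vectors are the columns of the upper unitriangular matrix carrying the coordinate flag of
`w` to `x`. -/
theorem exists_unipotent_column {I : Finset (Fin (n - 1))}
    {x : GrProd (n + I.card + 1) (ell I)} (hx : x ∈ windowFlags I)
    (hminor : ∀ j, ∃ b : Module.Basis (Fin (ell I j)) ℂ (x.space j),
      minorMap (fun a => wSeq I (Fin.castLE (ell_le I j) a))
        (fun c => (b c : Fin (n + I.card + 1) → ℂ)) ≠ 0) (m : Fin (n + I.card + 1)) :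
    ∃ v : Fin (n + I.card + 1) → ℂ, v m = 1 ∧ (∀ i, m < i → v i = 0) ∧
      ∀ j, ((wSeq I).symm m : ℕ) < ell I j → v ∈ x.space j := by
  by_cases hex : ∃ j, ((wSeq I).symm m : ℕ) < ell I j
  -- The flag is increasing, so membership in its first relevant member suffices.
  · obtain ⟨j, hj, hmin⟩ := WellFounded.has_min wellFounded_lt
      {j | ((wSeq I).symm m : ℕ) < ell I j} hex
    suffices h : ∃ v : Fin (n + I.card + 1) → ℂ, v m = 1 ∧ (∀ i, m < i → v i = 0) ∧
        v ∈ x.space j by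
      obtain ⟨v, h₁, h₂, h₃⟩ := h
      exact ⟨v, h₁, h₂, fun j' hj' => hx.1 (not_lt.mp (hmin j' hj')) h₃⟩
    by_cases hm : (m : ℕ) < h I j
    · exact ⟨Pi.single m 1, by simp, fun i hi => by simp [hi.ne'],
        (hx.2 j).1 (single_mem_stdSpace hm)⟩
    · obtain ⟨b, hb⟩ := hminor j
      rw [minorMap_apply] at hb
      set M := Matrix.of fun r c => (b c : Fin (n + I.card + 1) → ℂ)
        (wSeq I (Fin.castLE (ell_le I j) r)) with hM
      let a₀ : Fin (ell I j) := ⟨(wSeq I).symm m, hj⟩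
      -- Invertibility of the minor gives a vector of `x_j` with coordinate 1 at `m` and 0 at all
      -- other rows of the minor.
      let a := M⁻¹.mulVec (Pi.single a₀ 1)
      have ha : M.mulVec a = Pi.single a₀ 1 := by
        rw [Matrix.mulVec_mulVec, Matrix.mul_nonsing_inv _ (isUnit_iff_ne_zero.mpr hb),
          Matrix.one_mulVec]
      have hval : ∀ r : Fin (ell I j), ∑ c, a c * (b c : Fin (n + I.card + 1) → ℂ)
          (wSeq I (Fin.castLE (ell_le I j) r)) = (Pi.single a₀ 1 : Fin (ell I j) → ℂ) r := by
        intro r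
        rw [← ha, Matrix.mulVec, dotProduct]
        exact Finset.sum_congr rfl fun c _ => mul_comm _ _
      have hmem := sum_mem_of_basis b a
      refine ⟨_, ?_, fun i hi => ?_, hmem⟩
      · have := hval a₀
        rw [Pi.single_eq_same] at this
        have hw : wSeq I (Fin.castLE (ell_le I j) a₀) = m := (wSeq I).apply_symm_apply m
        rwa [hw] at this
      -- The rows of the minor that are at least `h_j` form an interval reaching the top of the
      -- window. So an index above `m` is either one of these rows or outside the window, and the
      -- coordinate vanishes in both cases.
      · by_cases hi' : (i : ℕ) < h I j + (n + 1)
        · have hmS := (wSeq_lt_iff I j ((wSeq I).symm m)).mp hj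
          rw [Equiv.apply_symm_apply] at hmS
          have hiS : ((wSeq I).symm i : ℕ) < ell I j := by
            rw [wSeq_lt_iff, Equiv.apply_symm_apply]
            have := Fin.lt_def.mp hi
            omega
          have := hval ⟨(wSeq I).symm i, hiS⟩
          have hw : wSeq I (Fin.castLE (ell_le I j) ⟨(wSeq I).symm i, hiS⟩) = i :=
            (wSeq I).apply_symm_apply i
          rw [hw, Pi.single_eq_of_ne] at this
          · exact this
          · intro e
            have h₁ := (wSeq I).symm.injective (Fin.ext (Fin.mk.inj_iff.mp e))
            exact hi.ne' h₁
        · exact (hx.2 j).2 hmem i (not_lt.mp hi')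
  · exact ⟨Pi.single m 1, by simp, fun i hi => by simp [hi.ne'], fun j hj => absurd ⟨j, hj⟩ hex⟩

/-- Within the window flags the cell contains the locus where finitely many minors are nonzero. This
makes membership a generic condition along a curve. -/
theorem mem_schubertCell {I : Finset (Fin (n - 1))}
    {x : GrProd (n + I.card + 1) (ell I)} (hx : x ∈ windowFlags I)
    (hminor : ∀ j, ∃ b : Module.Basis (Fin (ell I j)) ℂ (x.space j),
      minorMap (fun a => wSeq I (Fin.castLE (ell_le I j) a))
        (fun c => (b c : Fin (n + I.card + 1) → ℂ)) ≠ 0) :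
    x ∈ schubertCell (ell I) (wSeq I) := by
  choose v hv₁ hv₂ hv₃ using exists_unipotent_column hx hminor
  set B : Matrix (Fin (n + I.card + 1)) (Fin (n + I.card + 1)) ℂ :=
    Matrix.of fun i c => v c i with hB
  have htri : B.BlockTriangular id := fun i c hic => hv₂ c i hic
  have hdet : B.det = 1 := by
    rw [Matrix.det_of_isUpperTriangular htri]
    exact Finset.prod_eq_one fun i _ => hv₁ i
  refine ⟨⟨B, hdet⟩, htri, fun j => ?_⟩
  have hdet' : B.det ≠ 0 := by rw [hdet]; exact one_ne_zero
  refine (Submodule.eq_of_le_of_finrank_eq ?_ ?_).symm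
  · rw [Submodule.map_le_iff_le_comap, coordSpace, Submodule.span_le]
    rintro _ ⟨a, ha, rfl⟩
    change B.toLin' (Pi.single (wSeq I a) 1) ∈ x.space j
    rw [Matrix.toLin'_apply, Matrix.mulVec_single_one]
    refine hv₃ (wSeq I a) j ?_
    rwa [Equiv.symm_apply_apply]
  · rw [finrank_map_toLin' hdet', finrank_coordSpace _ (ell_le I j), x.finrank_space]

theorem exists_basis_map_stdSpace {N k : ℕ} (hk : k ≤ N) {A : Matrix (Fin N) (Fin N) ℂ}
    (hA : A.det ≠ 0) : ∃ b : Module.Basis (Fin k) ℂ ((stdSpace N k).map A.toLin'),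
      ∀ c, (b c : Fin N → ℂ) = fun i => A i (Fin.castLE hk c) := by
  have hcol : ∀ c, A.toLin' (Pi.single c 1) = fun i => A i c := fun c => by
    rw [Matrix.toLin'_apply, Matrix.mulVec_single_one]
    rfl
  have hmem : ∀ c : Fin k, (fun i => A i (Fin.castLE hk c)) ∈ (stdSpace N k).map A.toLin' :=
    fun c => ⟨Pi.single (Fin.castLE hk c) 1, single_mem_stdSpace c.2, hcol _⟩
  have hli : LinearIndependent ℂ fun c : Fin k =>
      (⟨_, hmem c⟩ : (stdSpace N k).map A.toLin') := by
    have h := Matrix.linearIndependent_cols_iff_isUnit.mpr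
      ((Matrix.isUnit_iff_isUnit_det A).mpr (isUnit_iff_ne_zero.mpr hA))
    have h' := h.comp (Fin.castLE hk) (Fin.castLE_injective hk)
    exact LinearIndependent.of_comp ((stdSpace N k).map A.toLin').subtype h'
  refine ⟨basisOfLinearIndependentOfCardEqFinrank' _ hli ?_, fun c => ?_⟩
  · rw [finrank_map_toLin' hA, finrank_stdSpace hk, Fintype.card_fin]
  · simp [basisOfLinearIndependentOfCardEqFinrank']

/-- The flag attached to a sequence of invertible matrices of Hessenberg type. -/
def hessenbergPoint (I : Finset (Fin (n - 1)))
    (g : ℕ → Matrix (Fin (n + I.card + 1)) (Fin (n + I.card + 1)) ℂ)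
    (hdet : ∀ s < n, (g s).det ≠ 0) : GrProd (n + I.card + 1) (ell I) where
  space j := (stdSpace _ (ell I j)).map (prodDown g n).toLin'
  finrank_space j := by
    rw [finrank_map_toLin' (det_prodDown_ne_zero hdet), finrank_stdSpace (ell_le I j)]

theorem hessenbergPoint_mem {I : Finset (Fin (n - 1))}
    {g : ℕ → Matrix (Fin (n + I.card + 1)) (Fin (n + I.card + 1)) ℂ}
    (hdet : ∀ s < n, (g s).det ≠ 0) (hg : ∀ s < n, IsHessenberg (hNat I s) (s + 1) (g s)) :
    hessenbergPoint I g hdet ∈ windowFlags I :=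
  ⟨fun _ _ hij => Submodule.map_mono (stdSpace_mono _ (ell_mono I hij)),
    fun j => prodDown_map_between (hNat_mono I) (fun s hs => ⟨hg s hs, hdet s hs⟩) j.2⟩

theorem exists_hessenbergPoint_eq {I : Finset (Fin (n - 1))}
    {x : GrProd (n + I.card + 1) (ell I)} (hx : x ∈ windowFlags I) :
    ∃ g : ℕ → Matrix (Fin (n + I.card + 1)) (Fin (n + I.card + 1)) ℂ,
      ∃ hdet : ∀ s < n, (g s).det ≠ 0, (∀ s < n, IsHessenberg (hNat I s) (s + 1) (g s)) ∧
        x = hessenbergPoint I g hdet := by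
  -- The value `⊤` beyond `n` is never consulted.
  set W : ℕ → Submodule ℂ (Fin (n + I.card + 1) → ℂ) :=
    fun s => if hs : s < n then x.space ⟨s, hs⟩ else ⊤
  have hW : ∀ s (hs : s < n), W s = x.space ⟨s, hs⟩ := fun s hs => dif_pos hs
  obtain ⟨g, hg, hgx⟩ := exists_prodDown_eq (hNat_mono I) (hNat_succ_le I) n W
    (fun s t hst ht => by
      rw [hW s (hst.trans_lt ht), hW t ht]
      exact hx.1 (Fin.mk_le_mk.mpr hst))
    (fun s hs => by
      rw [hW s hs]
      exact (hx.2 ⟨s, hs⟩).1)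
    (fun s hs => by
      rw [hW s hs]
      exact (hx.2 ⟨s, hs⟩).2)
    (fun s hs => by
      rw [hW s hs]
      exact x.finrank_space ⟨s, hs⟩)
    (fun s _ => by have := hNat_le_card I s; omega)
  refine ⟨g, fun s hs => (hg s hs).2, fun s hs => (hg s hs).1, ?_⟩
  apply GrProd.ext
  funext j
  exact (hW j j.2).symm.trans (hgx j j.2)

/-- The matrix of a permutation `w`, sending the `a`-th to the `w a`-th basis vector. -/
def permMat {N : ℕ} (w : Equiv.Perm (Fin N)) : Matrix (Fin N) (Fin N) ℂ :=
  Matrix.of fun i c => if i = w c then 1 else 0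

theorem prodDown_permMat {N : ℕ} (w : ℕ → Equiv.Perm (Fin N)) (m : ℕ) :
    prodDown (fun s => permMat (w s)) m = permMat (prodDown w m) := by
  induction m with
  | zero =>
    ext i c
    simp only [prodDown, permMat, Matrix.one_apply, Matrix.of_apply, Equiv.Perm.one_apply]
    split_ifs with h <;> simp [h]
  | succ m ih =>
    rw [prodDown, ih]
    ext i c
    simp only [prodDown, permMat, Matrix.mul_apply, Matrix.of_apply, Equiv.Perm.mul_apply, mul_ite,
      mul_one, mul_zero, Finset.sum_ite_eq', Finset.mem_univ, if_true]
    split_ifs with h <;> simp [h]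

theorem isHessenberg_permMat (I : Finset (Fin (n - 1))) {s : ℕ} (hs : s < n) :
    IsHessenberg (hNat I s) (s + 1) (permMat (wFactorNat I s)) := by
  intro i c hci hn
  simp only [permMat, Matrix.of_apply, ite_eq_right_iff, one_ne_zero, imp_false]
  intro e
  have := congrArg Fin.val e
  rw [wFactorNat_apply I hs] at this
  split_ifs at this <;> omega

theorem IsHessenberg.add_smul {N h r : ℕ} {A B : Matrix (Fin N) (Fin N) ℂ}
    (hA : IsHessenberg h r A) (hB : IsHessenberg h r B) (s t : ℂ) :
    IsHessenberg h r (s • A + t • B) := fun i c hci hn => by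
  simp [hA i c hci hn, hB i c hci hn]

/-! ### Lines of matrices and generic parameters -/

section Curve

variable {N : ℕ}

/-- The affine line through two matrices, as a matrix of polynomials. -/
def linePoly (A B : Matrix (Fin N) (Fin N) ℂ) : Matrix (Fin N) (Fin N) (Polynomial ℂ) :=
  Matrix.of fun i c =>
    (1 - Polynomial.X) * Polynomial.C (A i c) + Polynomial.X * Polynomial.C (B i c)

theorem map_linePoly (A B : Matrix (Fin N) (Fin N) ℂ) (t : ℂ) :
    (Polynomial.evalRingHom t).mapMatrix (linePoly A B) = (1 - t) • A + t • B := by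
  ext i c
  simp only [linePoly, RingHom.mapMatrix_apply, Matrix.map_apply, Matrix.of_apply, Matrix.add_apply,
    Matrix.smul_apply, smul_eq_mul, Polynomial.coe_evalRingHom, Polynomial.eval_add,
    Polynomial.eval_mul, Polynomial.eval_sub, Polynomial.eval_one, Polynomial.eval_X,
    Polynomial.eval_C]

theorem map_prodDown {M M' : Type*} [Monoid M] [Monoid M'] (f : M →* M') (g : ℕ → M) (m : ℕ) :
    f (prodDown g m) = prodDown (fun s => f (g s)) m := by
  induction m with
  | zero => exact f.map_one
  | succ m ih => rw [prodDown, prodDown, f.map_mul, ih]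

theorem eventually_eval_ne_zero {p : Polynomial ℂ} {t₀ : ℂ} (h : p.eval t₀ ≠ 0) :
    ∀ᶠ t in Filter.cofinite, p.eval t ≠ 0 := by
  have hp : p ≠ 0 := fun e => h (by simp [e])
  rw [Filter.eventually_cofinite]
  simpa [Polynomial.IsRoot] using Polynomial.finite_setOfPred_isRoot hp

end Curve

/-- The given flag is joined to the coordinate flag of `w` by moving all Hessenberg factors
simultaneously along lines. Hessenberg matrices form a linear space, so the curve stays in the
window flags wherever the factors are invertible. -/
theorem windowFlags_subset_closure (I : Finset (Fin (n - 1))) :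
    windowFlags I ⊆ closure (schubertCell (ell I) (wSeq I)) := by
  classical
  intro x hx
  obtain ⟨g, hdet, hg, rfl⟩ := exists_hessenbergPoint_eq hx
  set P := fun s => permMat (wFactorNat I s) with hP
  set γ : ℂ → ℕ → Matrix (Fin (n + I.card + 1)) (Fin (n + I.card + 1)) ℂ :=
    fun t s => (1 - t) • g s + t • P s with hγ
  have hγ0 : γ 0 = g := by funext s; simp [hγ]
  have hγ1 : γ 1 = P := by funext s; simp [hγ]
  have hγhess : ∀ t, ∀ s < n, IsHessenberg (hNat I s) (s + 1) (γ t s) := fun t s hs =>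
    (hg s hs).add_smul (isHessenberg_permMat I hs) _ _
  set Γ := fun s => linePoly (g s) (P s) with hΓ
  have hΓprod : ∀ t, (Polynomial.evalRingHom t).mapMatrix (prodDown Γ n) = prodDown (γ t) n := by
    intro t
    have := map_prodDown ((Polynomial.evalRingHom t).mapMatrix :
      Matrix (Fin (n + I.card + 1)) (Fin (n + I.card + 1)) (Polynomial ℂ) →+* _).toMonoidHom Γ n
    refine this.trans (prodDown_congr fun s _ => ?_)
    exact map_linePoly _ _ _
  have hγdet : ∀ᶠ t in Filter.cofinite, ∀ s < n, (γ t s).det ≠ 0 := by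
    refine (Filter.eventually_all_finite (Set.finite_lt_nat n)).mpr fun s hs => ?_
    have heval : ∀ t, (Γ s).det.eval t = (γ t s).det := fun t => by
      have := RingHom.map_det (Polynomial.evalRingHom t) (Γ s)
      rw [map_linePoly] at this
      exact this
    have := eventually_eval_ne_zero (p := (Γ s).det) (t₀ := 0) (by
      rw [heval, hγ0]
      exact hdet s hs)
    simpa only [heval] using this
  let q : ∀ j, (Fin (ell I j) → Fin (n + I.card + 1)) → Polynomial ℂ := fun j J =>
    Matrix.det (Matrix.of fun r c => prodDown Γ n (J r) (Fin.castLE (ell_le I j) c))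
  have hq : ∀ t j J, (q j J).eval t = minorMap J
      (fun (c : Fin (ell I j)) i => prodDown (γ t) n i (Fin.castLE (ell_le I j) c)) := by
    intro t j J
    rw [minorMap_apply, ← hΓprod]
    exact RingHom.map_det (Polynomial.evalRingHom t) _
  have hbasis : ∀ t (ht : ∀ s < n, (γ t s).det ≠ 0) j,
      ∃ b : Module.Basis (Fin (ell I j)) ℂ ((hessenbergPoint I (γ t) ht).space j),
        ∀ J, (q j J).eval t = minorMap J (fun c => (b c : Fin (n + I.card + 1) → ℂ)) := by
    intro t ht j
    obtain ⟨b, hb⟩ := exists_basis_map_stdSpace (ell_le I j) (det_prodDown_ne_zero ht)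
    refine ⟨b, fun J => ?_⟩
    rw [hq]
    congr 1
    funext c
    exact (hb c).symm
  have hplucker : ∀ t (ht : ∀ s < n, (γ t s).det ≠ 0),
      IsPlucker (hessenbergPoint I (γ t) ht) fun Q => (q Q.1 Q.2).eval t := by
    intro t ht
    rw [isPlucker_iff]
    intro j
    obtain ⟨b, hb⟩ := hbasis t ht j
    exact ⟨b, fun J => hb J⟩
  -- At the finitely many parameters with a singular factor the value is arbitrary.
  let pt : ℂ → GrProd (n + I.card + 1) (ell I) := fun t =>
    if ht : ∀ s < n, (γ t s).det ≠ 0 then hessenbergPoint I (γ t) ht else hessenbergPoint I g hdet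
  have hpt : ∀ t (ht : ∀ s < n, (γ t s).det ≠ 0), pt t = hessenbergPoint I (γ t) ht :=
    fun t ht => dif_pos ht
  -- Convergence along the cofinite filter of `ℂ` reflects the Zariski topology: a basic open
  -- condition restricts to a polynomial in `t`, and if that is nonzero at 0 it fails only finitely
  -- often.
  refine mem_closure_of_tendsto (f := pt) (b := Filter.cofinite) ?_ ?_
  · refine TopologicalSpace.tendsto_nhds_generateFrom_iff.mpr ?_
    rintro _ ⟨F, e, hF, rfl⟩ hmem
    let Fq : Polynomial ℂ := aeval (fun Q => q Q.1 Q.2) F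
    have hFq : ∀ t, Fq.eval t = eval (fun Q => (q Q.1 Q.2).eval t) F := by
      intro t
      have : (Polynomial.evalRingHom t).comp (aeval (fun Q : PluckerIndex _ (ell I) =>
          q Q.1 Q.2) : MvPolynomial (PluckerIndex (n + I.card + 1) (ell I)) ℂ →ₐ[ℂ] _).toRingHom =
          eval fun Q : PluckerIndex (n + I.card + 1) (ell I) => (q Q.1 Q.2).eval t := by
        apply MvPolynomial.ringHom_ext
        · intro r
          simp
        · intro Q
          simp
      exact congrArg (fun f => f F) this
    have h0 : Fq.eval 0 ≠ 0 := by
      rw [hFq]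
      refine hmem _ ?_
      have hd0 : ∀ s < n, (γ 0 s).det ≠ 0 := by rwa [hγ0]
      have := hplucker 0 hd0
      have heq : hessenbergPoint I (γ 0) hd0 = hessenbergPoint I g hdet := by
        simp only [hγ0]
      rwa [heq] at this
    filter_upwards [eventually_eval_ne_zero h0, hγdet] with t ht htd
    rw [Set.mem_preimage, hpt t htd, Set.mem_ofPred_eq,
      hF.forall_eval_ne_zero_iff (hplucker t htd), ← hFq]
    exact ht
  · have hminor : ∀ᶠ t in Filter.cofinite, ∀ j,
        (q j fun a => wSeq I (Fin.castLE (ell_le I j) a)).eval t ≠ 0 := by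
      rw [Filter.eventually_all]
      intro j
      -- At parameter 1 the product is the permutation matrix of `w`, whose minor on these rows is
      -- that of the identity matrix.
      refine eventually_eval_ne_zero (t₀ := 1) ?_
      rw [hq, hγ1, hP, prodDown_permMat, ← wSeq_eq_prodDown, minorMap_apply]
      have : (Matrix.of fun r c : Fin (ell I j) => permMat (wSeq I)
          (wSeq I (Fin.castLE (ell_le I j) r)) (Fin.castLE (ell_le I j) c)) = 1 := by
        ext r c
        simp [permMat, Matrix.one_apply]
      rw [this, Matrix.det_one]
      exact one_ne_zero
    filter_upwards [hminor, hγdet] with t ht htd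
    rw [hpt t htd]
    refine mem_schubertCell (hessenbergPoint_mem htd (hγhess t)) fun j => ?_
    obtain ⟨b, hb⟩ := hbasis t htd j
    refine ⟨b, ?_⟩
    rw [← hb]
    exact ht j

/-- The Schubert variety of a projection sequence is defined by the inclusion conditions
`ℂ^{h_j} ⊆ W_j ⊆ ℂ^{h_j+n+1}`. -/
theorem schubertVariety_eq_windowFlags (I : Finset (Fin (n - 1))) :
    schubertVariety (ell I) (wSeq I) = windowFlags I :=
  (schubertVariety_subset_windowFlags I).antisymm fun _ hx =>
    ⟨windowFlags_subset_closure I hx, hx.1⟩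

theorem nonempty_varietyIso_schubertVariety (I : Finset (Fin (n - 1))) :
    Nonempty (VarietyIso (linDegFlag (prSeq I)) (schubertVariety (ell I) (wSeq I))) := by
  rw [schubertVariety_eq_windowFlags]
  exact ⟨windowIso I⟩

end

end LinDegFlag

end

theorem mainTheorem5 (n : ℕ) (hn : 1 ≤ n) :
    (∀ I : Finset (Fin (n - 1)),
      Nonempty (LinDegFlag.VarietyIso (LinDegFlag.linDegFlag (LinDegFlag.prSeq I))
        (LinDegFlag.schubertVariety (LinDegFlag.ell I) (LinDegFlag.wSeq I)))) ∧
    (∀ I : Finset (Fin (n - 1)), LinDegFlag.prSeq I ∈ LinDegFlag.pbwLocus n) ∧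
    (∀ f ∈ LinDegFlag.pbwLocus n, ∃ I : Finset (Fin (n - 1)),
      f ∈ LinDegFlag.orbit (LinDegFlag.prSeq I) ∧
      (∀ I' : Finset (Fin (n - 1)), f ∈ LinDegFlag.orbit (LinDegFlag.prSeq I') → I' = I) ∧
      Nonempty (LinDegFlag.VarietyIso (LinDegFlag.linDegFlag f)
        (LinDegFlag.schubertVariety (LinDegFlag.ell I) (LinDegFlag.wSeq I)))) := by
  refine ⟨LinDegFlag.nonempty_varietyIso_schubertVariety, LinDegFlag.prSeq_mem_pbwLocus,
    fun f hf => ?_⟩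
  obtain ⟨I, hI⟩ := LinDegFlag.exists_mem_orbit_prSeq hf
  refine ⟨I, hI, fun I' hI' => LinDegFlag.eq_of_mem_orbit_prSeq hI hI', ?_⟩
  obtain ⟨e⟩ := LinDegFlag.nonempty_varietyIso_of_mem_orbit (LinDegFlag.orbit_symm hI)
  obtain ⟨e'⟩ := LinDegFlag.nonempty_varietyIso_schubertVariety I
  exact ⟨e.trans e'⟩
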